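/- **Property (minimized IRVA are canonical).** *Polyhedra and components.* Let $n\ge 1$ and let $P\subseteq\mathbb R^n$ be a polyhedron, i.e. a finite Boolean combination of linear constraints $\vec a\cdot\vec x\,\#\,b$ with $\vec a\in\mathbb Z^n$, $b\in\mathbb Z$, $\#\in\{<,\le,=,\ge,>\}$. A set $S$ is *conical* in $D$ with apex $\vec v\in D$ if for all $\vec x\in D$ and $\lambda\in(0,1)$: $\vec x\in S\Leftrightarrow\lambda(\vec x-\vec v)+\vec v\in S$. Assume that $P$ is conical in $\mathbb R^n$ with apex $\vec 0$. The *component* $P_{\vec v}$ of $P$ at $\vec v$ is $\{\vec x\in[-\frac12,\frac12]^n : \vec v+\varepsilon\vec x\in P$ for all sufficiently small $\varepsilon>0\}$; it is *in* if $\vec v\in P$ and *out* otherwise. Its vector space $\mathrm{VS}(P_{\vec v})$ is the span of the apexes with respect to which $P_{\vec v}$ is conical in $[-\frac12,\frac12]^n$. For distinct components, $Q_1\prec Q_2$ means that every neighborhood of every point whose component is $Q_1$ contains a point whose component is $Q_2$. *Encodings.* For a vector space $W\subseteq\mathbb R^n$ of dimension $m<n$, complete $W$ by $n-m$ standard unit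 vectors chosen greedily in increasing order, and let $\vec z\in\mathbb R^{n-m}$ be the coordinates of $\vec v\notin W$ along them. Put $[\vec z]=\vec z/(2\max_i|z_i|)$. An encoding of $\vec v$ relative to $W$ is a word $a\,w$, where $a=\pm i$ is such that $[\vec z]_i=\pm\frac12$, and $w\in\{0,1\}^\omega$ is a serialized binary encoding of the fractional digits of the vector obtained from $[\vec z]$ by removing the $i$-th entry and adding $\frac12$ to the others (any $w$ if $n-m=1$). For a finite prefix $a\,u$, $R_{W,au}$ is the set of the vectors having an encoding with this prefix. *IRVA.* An IRVA of dimension $n$ has a finite set $S_I$ of implicit states $s$, each with a vector space $\mathrm{VS}(s)\subseteq\mathbb R^n$ and a polarity in $\{\text{in},\text{out}\}$, a finite disjoint set $S_E$ of explicit states, an initial state $s_0\in S_I$ and a partial transition function $\Delta: S_I\times\pm\mathbb N_{>0}\cup S_E\times\{0,1\}\to S_I\cup S_E$. Its decision procedure for $\vec v$ starts at $s_0$; at $s\in S_I$, if $\vec v\in\mathrm{VS}(s)$ it answers the polarity of $s$, otherwise it follows from $s$ an arbitrarily chosen encoding of $\vec v$ relative to $\mathrm{VS}(s)$ up to the next implicit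 state, and goes on from there. The IRVA *represents* $P$ if: 1. $\Delta$ is acyclic; $\mathrm{VS}(s_1)\subsetneq\mathrm{VS}(s_2)$ whenever $s_2\in S_I$ is reachable from $s_1\in S_I$; $\Delta(s,\pm i)$ is defined iff $i\le n-\dim\mathrm{VS}(s)$; $\Delta(e,0)$ and $\Delta(e,1)$ are defined for all $e\in S_E$; 2. every $s\in S_I$ corresponds, in whole or in part, to a component $c(s)$ of $P$: $\mathrm{VS}(s)\subseteq\mathrm{VS}(c(s))$, the polarities of $s$ and $c(s)$ agree, and $c(s_0)=P_{\vec 0}$; whenever reading $a\,u$ from $s\in S_I$ leads to $s'\in S_I$, $c(s')$ is the unique $\prec$-minimal component among those covered by $R_{\mathrm{VS}(s),au}$ (translated to the points with component $c(s)$) in arbitrarily small neighborhoods of these points; every component $Q$ is described by some state $s$, i.e. $c(s)=Q$ and $\mathrm{VS}(s)=\mathrm{VS}(Q)$; and if $Q_1\prec Q_2$, some state describing $Q_2$ is reachable from some state describing $Q_1$; 3. for every $\vec v$ and every choice of encodings, the procedure answers *in* iff $\vec v\in P$. *Minimized.* An IRVA representing $P$ is *minimized* if all its states are reachable from $s_0$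 and none of the following reductions applies: merging two distinct explicit states with the same successors; merging two distinct implicit states with the same successors, vector space and polarity; absorbing a state $x$ into an implicit state $s_1$ (deleting $x$ and redirecting to $s_1$ what led to $x$), where $x$ has a transition to $s_1$, $s_1$ describes a component, every implicit state reachable from $x$ by at least one transition is $s_1$ or is reachable from $s_1$, and, if $x$ is implicit, $x$ has the same polarity as $s_1$ and the absorption leaves the set decided by the procedure equal to $P$. *Claim.* If $\mathcal A_1$ and $\mathcal A_2$ are two minimized IRVA representing the same polyhedron $P$, then there are bijections $S_I^1\to S_I^2$ and $S_E^1\to S_E^2$ that map the initial state of $\mathcal A_1$ to that of $\mathcal A_2$, commute with the transition functions (including where they are undefined), and preserve the polarities and the vector spaces of the implicit states: corresponding implicit states have equal vector spaces. -/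

import Mathlib

/-! ### Polyhedra, conical sets and polyhedral components -/

/-- Polyhedra: finite Boolean combinations of linear constraints with integer coefficients. -/
inductive IsPolyhedron {n : ℕ} : Set (Fin n → ℝ) → Prop
  | lt (a : Fin n → ℤ) (b : ℤ) : IsPolyhedron {x | ∑ i, (a i : ℝ) * x i < (b : ℝ)}
  | le (a : Fin n → ℤ) (b : ℤ) : IsPolyhedron {x | ∑ i, (a i : ℝ) * x i ≤ (b : ℝ)}
  | eq (a : Fin n → ℤ) (b : ℤ) : IsPolyhedron {x | ∑ i, (a i : ℝ) * x i = (b : ℝ)}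
  | ge (a : Fin n → ℤ) (b : ℤ) : IsPolyhedron {x | ∑ i, (a i : ℝ) * x i ≥ (b : ℝ)}
  | gt (a : Fin n → ℤ) (b : ℤ) : IsPolyhedron {x | ∑ i, (a i : ℝ) * x i > (b : ℝ)}
  | compl {P : Set (Fin n → ℝ)} : IsPolyhedron P → IsPolyhedron Pᶜ
  | inter {P Q : Set (Fin n → ℝ)} : IsPolyhedron P → IsPolyhedron Q → IsPolyhedron (P ∩ Q)
  | union {P Q : Set (Fin n → ℝ)} : IsPolyhedron P → IsPolyhedron Q → IsPolyhedron (P ∪ Q)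

/-- `P` is conical in `D` with respect to the apex `v`. -/
def ConicalIn {n : ℕ} (P D : Set (Fin n → ℝ)) (v : Fin n → ℝ) : Prop :=
  v ∈ D ∧ ∀ x ∈ D, ∀ t ∈ Set.Ioo (0 : ℝ) 1, (x ∈ P ↔ t • (x - v) + v ∈ P)

/-- The cube `[-1/2, 1/2]^n`. -/
def unitCube (n : ℕ) : Set (Fin n → ℝ) :=
  {x | ∀ i, x i ∈ Set.Icc (-(1 / 2) : ℝ) (1 / 2)}

/-- The component `P_v` of `P` associated to `v`: the value, for all sufficiently small `ε > 0`,
of the normalized view `(1/ε) ((P ∩ N_ε(v)) - v)` of `P` in the cube of size `ε` centered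
on `v`. -/
def component {n : ℕ} (P : Set (Fin n → ℝ)) (v : Fin n → ℝ) : Set (Fin n → ℝ) :=
  {x | x ∈ unitCube n ∧ ∀ᶠ ε in nhdsWithin (0 : ℝ) (Set.Ioi 0), v + ε • x ∈ P}

def IsComponent {n : ℕ} (P Q : Set (Fin n → ℝ)) : Prop := ∃ v, component P v = Q

/-- The vector space of a component `Q`: the one whose trace on the cube `[-1/2, 1/2]^n` is the
set of the apexes with respect to which `Q` is conical in the cube. -/
def componentSpace {n : ℕ} (Q : Set (Fin n → ℝ)) : Submodule ℝ (Fin n → ℝ) :=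
  Submodule.span ℝ {v | ConicalIn Q (unitCube n) v}

/-- The incidence relation `Q₁ ≺ Q₂` between components of `P`. -/
def Incident {n : ℕ} (P Q₁ Q₂ : Set (Fin n → ℝ)) : Prop :=
  IsComponent P Q₁ ∧ IsComponent P Q₂ ∧ Q₁ ≠ Q₂ ∧
    ∀ v₁, component P v₁ = Q₁ → ∀ ε > (0 : ℝ), ∃ v₂, component P v₂ = Q₂ ∧ ‖v₁ - v₂‖ < ε

/-- The components of `P` that the conical region `R` covers in every neighborhood of the points
of the component `Q` (the apex of the region being moved to these points). -/
def coveredComponents {n : ℕ} (P Q R : Set (Fin n → ℝ)) : Set (Set (Fin n → ℝ)) :=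
  {Q' | ∀ q, component P q = Q → ∀ ε > (0 : ℝ), ∃ x ∈ R, ‖x‖ < ε ∧ component P (q + x) = Q'}

/-- `Q` is the one and only element of `U` that is minimal for the incidence relation of `P`. -/
def IsUniqueMinimal {n : ℕ} (P : Set (Fin n → ℝ)) (U : Set (Set (Fin n → ℝ)))
    (Q : Set (Fin n → ℝ)) : Prop :=
  ∀ Q', (Q' ∈ U ∧ ∀ Q'' ∈ U, ¬ Incident P Q'' Q') ↔ Q' = Q

/-! ### Encodings -/

/-- The indices of the standard unit vectors that complete (a basis of) `W` into a basis of `ℝ^n`,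
selected greedily in increasing order. There are `n - dim W` of them. -/
noncomputable def complIndices {n : ℕ} (W : Submodule ℝ (Fin n → ℝ)) : Finset (Fin n) :=
  open scoped Classical in
  Finset.univ.filter fun i =>
    (Pi.single i 1 : Fin n → ℝ) ∉
      W ⊔ Submodule.span ℝ {x | ∃ j < i, x = (Pi.single j 1 : Fin n → ℝ)}

/-- The `k`-th complementing unit vector. -/
noncomputable def complVector {n : ℕ} (W : Submodule ℝ (Fin n → ℝ))
    (k : Fin (complIndices W).card) : Fin n → ℝ :=
  Pi.single ((complIndices W).orderEmbOfFin rfl k) 1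

/-- `z` is the vector of the coordinates of `v` along the complementing unit vectors. -/
def IsComplCoord {n : ℕ} (W : Submodule ℝ (Fin n → ℝ)) (v : Fin n → ℝ)
    (z : Fin (complIndices W).card → ℝ) : Prop :=
  v - ∑ k, z k • complVector W k ∈ W

/-- Normalized form `z / (2 max_i |z_i|)` (the norm is the maximum norm). -/
noncomputable def normalizedForm {d : ℕ} (z : Fin d → ℝ) : Fin d → ℝ := (1 / (2 * ‖z‖)) • z

/-- Symbols `±1, ±2, …`: a sign (`true` for `+`) and a positive integer. -/
abbrev FaceSymbol := Bool × ℕ+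

/-- The position of the component `j ≠ i` once the component `i` is removed. -/
def posWithout {d : ℕ} (i j : Fin d) : ℕ := if j < i then (j : ℕ) else (j : ℕ) - 1

/-- `a w` encodes the vector `v ∉ W` relatively to `W`: the symbol `a = ±(i+1)` designates a face
of the normalization cube to which the normalized form of the coordinates of `v` belongs, and `w`
is a serialized binary encoding of the other components, offset by `1/2`: the `k`-th binary digits
of these `d - 1` components are read in turn, then the digits of rank `k + 1`, and so on. -/
def IsEncoding {n : ℕ} (W : Submodule ℝ (Fin n → ℝ)) (v : Fin n → ℝ)
    (a : FaceSymbol) (w : ℕ → Bool) : Prop :=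
  ∃ z : Fin (complIndices W).card → ℝ, IsComplCoord W v z ∧ z ≠ 0 ∧
    ∃ i : Fin (complIndices W).card, (i : ℕ) + 1 = (a.2 : ℕ) ∧
      normalizedForm z i = (if a.1 then 1 / 2 else -(1 / 2)) ∧
      ∀ j, j ≠ i →
        HasSum (fun k : ℕ =>
            ((w (k * ((complIndices W).card - 1) + posWithout i j)).toNat : ℝ) / 2 ^ (k + 1))
          (normalizedForm z j + 1 / 2)

/-- The region of the vectors that admit an encoding with prefix `a u`. -/
def prefixRegion {n : ℕ} (W : Submodule ℝ (Fin n → ℝ)) (a : FaceSymbol) (u : List Bool) :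
    Set (Fin n → ℝ) :=
  {v | ∃ w, IsEncoding W v a w ∧ List.ofFn (fun k : Fin u.length => w k) = u}

/-! ### Implicit Real Vector Automata -/

/-- Implicit Real Vector Automata of dimension `n`, with implicit states `SI` and explicit
states `SE`. Polarity `true` means *in*. -/
structure IRVA (n : ℕ) (SI SE : Type*) where
  VS : SI → Submodule ℝ (Fin n → ℝ)
  pol : SI → Bool
  init : SI
  stepI : SI → FaceSymbol → Option (SI ⊕ SE)
  stepE : SE → Bool → Option (SI ⊕ SE)

namespace IRVA

variable {n : ℕ} {SI SE : Type*}

/-- There is a transition from a state to another one. -/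
inductive Trans (A : IRVA n SI SE) : SI ⊕ SE → SI ⊕ SE → Prop
  | implicit (s : SI) (a : FaceSymbol) (y : SI ⊕ SE) :
      A.stepI s a = some y → Trans A (Sum.inl s) y
  | explicit (e : SE) (b : Bool) (y : SI ⊕ SE) :
      A.stepE e b = some y → Trans A (Sum.inr e) y

/-- `y` is reachable from `x` by one transition or more. -/
def Reaches (A : IRVA n SI SE) (x y : SI ⊕ SE) : Prop := Relation.TransGen A.Trans x y

/-- Follow transitions labelled by bits; only explicit states have such transitions. -/
def readBits (A : IRVA n SI SE) : SI ⊕ SE → List Bool → Option (SI ⊕ SE)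
  | x, [] => some x
  | Sum.inl _, _ :: _ => none
  | Sum.inr e, b :: u => (A.stepE e b).bind fun y => readBits A y u

/-- The state reached from the implicit state `s` by reading the word `a u`. -/
def read (A : IRVA n SI SE) (s : SI) (a : FaceSymbol) (u : List Bool) : Option (SI ⊕ SE) :=
  (A.stepI s a).bind fun y => A.readBits y u

/-- One round of the decision procedure for `v`: from the implicit state `s`, follow an encoding
of `v` until a new implicit state `s'` is reached. -/
def Moves (A : IRVA n SI SE) (v : Fin n → ℝ) (s s' : SI) : Prop :=
  ∃ a w k, IsEncoding (A.VS s) v a w ∧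
    A.read s a (List.ofFn fun j : Fin k => w j) = some (Sum.inl s')

/-- The decision procedure for `v`, started at an implicit state, can answer the given Boolean. -/
inductive Answers (A : IRVA n SI SE) (v : Fin n → ℝ) : SI → Bool → Prop
  | halt (s : SI) : v ∈ A.VS s → Answers A v s (A.pol s)
  | move (s s' : SI) (b : Bool) :
      v ∉ A.VS s → A.Moves v s s' → Answers A v s' b → Answers A v s b

/-- Whatever encodings are chosen, the procedure decides membership in `P`. -/
def Decides (A : IRVA n SI SE) (P : Set (Fin n → ℝ)) : Prop :=
  ∀ v b, A.Answers v A.init b ↔ (b = true ↔ v ∈ P)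

/-- Integrity constraints that do not mention the represented polyhedron. -/
structure WellFormed (A : IRVA n SI SE) : Prop where
  acyclic : ∀ x, ¬ A.Reaches x x
  increasing : ∀ s₁ s₂, A.Reaches (Sum.inl s₁) (Sum.inl s₂) → A.VS s₁ < A.VS s₂
  completeI : ∀ s a, (A.stepI s a).isSome ↔ (a.2 : ℕ) ≤ n - Module.finrank ℝ (A.VS s)
  completeE : ∀ e b, (A.stepE e b).isSome

/-- `c` associates to each implicit state the component of `P` to which it corresponds (as a whole,
or in part: its vector space is then a proper subspace of the one of the component). -/
structure IsLabelling (A : IRVA n SI SE) (P : Set (Fin n → ℝ)) (c : SI → Set (Fin n → ℝ)) :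
    Prop where
  isComponent : ∀ s, IsComponent P (c s)
  space_le : ∀ s, A.VS s ≤ componentSpace (c s)
  polarity : ∀ s v, component P v = c s → (A.pol s = true ↔ v ∈ P)
  initial : c A.init = component P 0
  /-- The decision structure that leaves `s` leads to an implicit state only when this state
  corresponds to the unique minimal component among the covered ones. -/
  sound : ∀ s a u s', A.read s a u = some (Sum.inl s') →
    IsUniqueMinimal P (coveredComponents P (c s) (prefixRegion (A.VS s) a u)) (c s')
  described : ∀ Q, IsComponent P Q → ∃ s, c s = Q ∧ A.VS s = componentSpace Q
  incidence : ∀ Q₁ Q₂, Incident P Q₁ Q₂ → ∃ s₁ s₂,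
    (c s₁ = Q₁ ∧ A.VS s₁ = componentSpace Q₁) ∧ (c s₂ = Q₂ ∧ A.VS s₂ = componentSpace Q₂) ∧
      A.Reaches (Sum.inl s₁) (Sum.inl s₂)

/-- `A` is a well-formed IRVA that represents the polyhedron `P`. -/
def Represents (A : IRVA n SI SE) (P : Set (Fin n → ℝ)) : Prop :=
  A.WellFormed ∧ (∃ c, A.IsLabelling P c) ∧ A.Decides P

/-- The result of absorbing the implicit state `s` into `s₁`: all transitions that lead to `s`
(and the initial mark) are redirected to `s₁`. The state `s`, which has become unreachable, is left
in place; it does not influence the decision procedure any more. -/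
noncomputable def absorb (A : IRVA n SI SE) (s s₁ : SI) : IRVA n SI SE :=
  open scoped Classical in
  { VS := A.VS
    pol := A.pol
    init := if A.init = s then s₁ else A.init
    stepI := fun t a => (A.stepI t a).map fun y => if y = Sum.inl s then Sum.inl s₁ else y
    stepE := fun e b => (A.stepE e b).map fun y => if y = Sum.inl s then Sum.inl s₁ else y }

/-- The hypotheses of the absorption rule that are common to explicit and implicit states: the
state `x` has a transition to `s₁`, which represents a component of `P`, and all implicit states
reachable from `x` are reachable from `s₁` (which is considered as reachable from itself). -/
def AbsorptionCandidate (A : IRVA n SI SE) (P : Set (Fin n → ℝ)) (x : SI ⊕ SE) (s₁ : SI) : Prop :=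
  A.Trans x (Sum.inl s₁) ∧
  (∃ c, A.IsLabelling P c ∧ A.VS s₁ = componentSpace (c s₁)) ∧
  ∀ t : SI, A.Reaches x (Sum.inl t) → t = s₁ ∨ A.Reaches (Sum.inl s₁) (Sum.inl t)

/-- `A` is minimized, as a representation of `P`: all states can be reached, and no reduction rule
(merging of indistinguishable states, absorption of unnecessary decisions) applies. -/
structure IsMinimized (A : IRVA n SI SE) (P : Set (Fin n → ℝ)) : Prop where
  reachable : ∀ x, x = Sum.inl A.init ∨ A.Reaches (Sum.inl A.init) x
  merge_explicit : ∀ e e' : SE, (∀ b, A.stepE e b = A.stepE e' b) → e = e'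
  merge_implicit : ∀ s s' : SI, A.VS s = A.VS s' → A.pol s = A.pol s' →
    (∀ a, A.stepI s a = A.stepI s' a) → s = s'
  absorb_explicit : ∀ (e : SE) (s₁ : SI), ¬ A.AbsorptionCandidate P (Sum.inr e) s₁
  /-- An implicit state is absorbed only by a state of the same polarity, and only when this does
  not modify the represented set. -/
  absorb_implicit : ∀ s s₁ : SI, A.AbsorptionCandidate P (Sum.inl s) s₁ → A.pol s = A.pol s₁ →
    ¬ (A.absorb s s₁).Decides P

end IRVA

/-!
A polyhedron is *locally conical* (`IsPolyhedron.locallyConical`): near each point `q` it coincides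
with its tangent cone `localCone P q`, which the component at `q` determines, and whose lineality
space is the vector space of the component (`componentSpace_component`). Along the incidence relation
this vector space strictly grows, so that incidence is a strict order in which induction is possible,
and a unique minimal covered component is a least one.

*Labels suffice for deciding.* The regions of the encoding prefixes are convex up to scaling. If such
a region `R` covers a unique minimal component `Q'` around a component `Q`, then the cones of `Q` and
`Q'` have the same trace on `R` (`IsUniqueMinimal.mem_localCone_iff`): along the segment from a point
of `R` to a point `y` with component `Q'`, all components met are above `Q'`, hence invariant in the
direction `y`, and membership does not change. So membership in the cone of the label is an invariant
of the decision procedure, and every automaton with a sound labelling decides `P`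
(`IRVA.IsSoundLabelling.decides`). In particular an implicit state can always be absorbed by a state
with the same label.

*A minimized automaton has no freedom.* By induction from the largest components down, each component
`Q` labels exactly one implicit state (`IRVA.IsLabelling.hasUniqueState`). A state describing `Q` is
eager: if a prefix determines a unique minimal component and yet leads to an explicit state, the
unique state of this component is still reached, all else that is reached lies above it, and the last
explicit state before it can be absorbed. Hence the label of a state describing `Q` determines what is
observed by reading words from it, and the merging rules leave only one such state. A state labelled
with `Q` that does not describe it leads to the one that does, and the absorption rules remove it.

The implicit states of a minimized automaton are thus in bijection with the components. Its explicit
states are determined by their behaviours, which are those that the residual words from the eager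
implicit states impose; so both automata have the same, and the bijections follow.
-/

open Filter Topology Set

/-! ### Locally conical sets and their tangent cones -/


/-- The tangent cone of `P` at `q`: the directions along which `P` is entered from `q`. The
component of `P` at `q` is its trace on the cube. -/
def localCone {n : ℕ} (P : Set (Fin n → ℝ)) (q : Fin n → ℝ) : Set (Fin n → ℝ) :=
  {x | ∀ᶠ ε in 𝓝[>] (0 : ℝ), q + ε • x ∈ P}

/-- A set that coincides near each point of the space with a cone whose apex is this point. -/
def LocallyConical {n : ℕ} (P : Set (Fin n → ℝ)) : Prop :=
  ∀ q, ∃ δ > (0 : ℝ), ∀ x, ‖x‖ < δ → ∀ t ∈ Ioc (0 : ℝ) 1, (q + x ∈ P ↔ q + t • x ∈ P)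

/-- Invariance under positive scaling. The origin may or may not belong to the set. -/
def IsScalingInvariant {n : ℕ} (C : Set (Fin n → ℝ)) : Prop :=
  ∀ r > (0 : ℝ), ∀ x, r • x ∈ C ↔ x ∈ C

/-- The lineality space of `C`: the vectors all of whose multiples leave `C` invariant by
translation. -/
def lineality {n : ℕ} (C : Set (Fin n → ℝ)) : Submodule ℝ (Fin n → ℝ) where
  carrier := {v | ∀ (r : ℝ) (x), x + r • v ∈ C ↔ x ∈ C}
  add_mem' := by
    intro v w hv hw r x
    rw [smul_add, ← add_assoc, hw, hv]
  zero_mem' := by intro r x; simp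
  smul_mem' := by
    intro c v hv r x
    rw [smul_smul, hv]

section tangent

variable {n : ℕ}

theorem exists_sign_affine_eq (a : Fin n → ℤ) (b : ℤ) (q : Fin n → ℝ) :
    ∃ δ > (0 : ℝ), ∀ x, ‖x‖ < δ → ∀ t ∈ Ioc (0 : ℝ) 1,
      SignType.sign (∑ i, (a i : ℝ) * (q + x) i - b) =
        SignType.sign (∑ i, (a i : ℝ) * (q + t • x) i - b) := by
  by_cases hq : ∑ i, (a i : ℝ) * q i = b
  · refine ⟨1, one_pos, fun x _ t ht => ?_⟩
    have h1 : ∑ i, (a i : ℝ) * (q + x) i - b = ∑ i, (a i : ℝ) * x i := by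
      simp only [Pi.add_apply, mul_add, Finset.sum_add_distrib, hq]; ring
    have h2 : ∑ i, (a i : ℝ) * (q + t • x) i - b = t * ∑ i, (a i : ℝ) * x i := by
      simp only [Pi.add_apply, Pi.smul_apply, smul_eq_mul, mul_add, Finset.sum_add_distrib, hq,
        Finset.mul_sum]
      rw [add_sub_cancel_left]
      exact Finset.sum_congr rfl fun i _ => by ring
    rw [h1, h2, sign_mul, sign_pos ht.1, one_mul]
  · have hc : Continuous fun x : Fin n → ℝ => ∑ i, (a i : ℝ) * (q + x) i - (b : ℝ) := by
      simp only [Pi.add_apply]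
      fun_prop
    have key : ∀ᶠ x in 𝓝 (0 : Fin n → ℝ), SignType.sign (∑ i, (a i : ℝ) * (q + x) i - b) =
        SignType.sign (∑ i, (a i : ℝ) * q i - b) := by
      have h0 : (fun x : Fin n → ℝ => ∑ i, (a i : ℝ) * (q + x) i - (b : ℝ)) 0
          = ∑ i, (a i : ℝ) * q i - b := by simp
      rcases lt_or_gt_of_ne (sub_ne_zero.2 hq) with h | h
      · have := hc.continuousAt.eventually_lt_const (h0.trans_lt h)
        filter_upwards [this] with x hx
        rw [sign_neg hx, sign_neg h]
      · have := hc.continuousAt.eventually_const_lt (h.trans_eq h0.symm)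
        filter_upwards [this] with x hx
        rw [sign_pos hx, sign_pos h]
    obtain ⟨δ, hδ, H⟩ := Metric.eventually_nhds_iff.1 key
    refine ⟨δ, hδ, fun x hx t ht => ?_⟩
    rw [H (by simpa using hx), H]
    rw [dist_zero_right, norm_smul, Real.norm_eq_abs, abs_of_pos ht.1]
    exact (mul_le_of_le_one_left (norm_nonneg x) ht.2).trans_lt hx

theorem locallyConical_of_sign (a : Fin n → ℤ) (b : ℤ) (p : SignType → Prop) :
    LocallyConical {x | p (SignType.sign (∑ i, (a i : ℝ) * x i - (b : ℝ)))} := by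
  intro q
  obtain ⟨δ, hδ, h⟩ := exists_sign_affine_eq a b q
  exact ⟨δ, hδ, fun x hx t ht => by simp only [mem_ofPred_eq, h x hx t ht]⟩

theorem IsPolyhedron.locallyConical {P : Set (Fin n → ℝ)} (hP : IsPolyhedron P) :
    LocallyConical P := by
  induction hP with
  | lt a b =>
    convert! locallyConical_of_sign a b (fun s => s = -1) using 3
    rw [sign_eq_neg_one_iff, sub_neg]
  | le a b =>
    convert! locallyConical_of_sign a b (fun s => s ≠ 1) using 3
    rw [Ne, sign_eq_one_iff, sub_pos, not_lt]
  | eq a b =>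
    convert! locallyConical_of_sign a b (fun s => s = 0) using 3
    rw [sign_eq_zero_iff, sub_eq_zero]
  | ge a b =>
    convert! locallyConical_of_sign a b (fun s => s ≠ -1) using 3
    rw [Ne, sign_eq_neg_one_iff, sub_neg, not_lt]
  | gt a b =>
    convert! locallyConical_of_sign a b (fun s => s = 1) using 3
    rw [sign_eq_one_iff, sub_pos]
  | compl _ ih =>
    intro q
    obtain ⟨δ, hδ, h⟩ := ih q
    exact ⟨δ, hδ, fun x hx t ht => not_congr (h x hx t ht)⟩
  | inter _ _ ih₁ ih₂ =>
    intro q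
    obtain ⟨δ, hδ, h⟩ := ih₁ q
    obtain ⟨η, hη, h'⟩ := ih₂ q
    exact ⟨min δ η, lt_min hδ hη, fun x hx t ht =>
      and_congr (h x (hx.trans_le (min_le_left _ _)) t ht)
        (h' x (hx.trans_le (min_le_right _ _)) t ht)⟩
  | union _ _ ih₁ ih₂ =>
    intro q
    obtain ⟨δ, hδ, h⟩ := ih₁ q
    obtain ⟨η, hη, h'⟩ := ih₂ q
    exact ⟨min δ η, lt_min hδ hη, fun x hx t ht =>
      or_congr (h x (hx.trans_le (min_le_left _ _)) t ht)
        (h' x (hx.trans_le (min_le_right _ _)) t ht)⟩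

theorem tendsto_smul_zero (x : Fin n → ℝ) :
    Tendsto (fun ε : ℝ => ε • x) (𝓝[>] 0) (𝓝 0) := by
  have : Tendsto (fun ε : ℝ => ε • x) (𝓝 0) (𝓝 ((0 : ℝ) • x)) := by
    exact (continuous_id.smul continuous_const).tendsto 0
  rw [zero_smul] at this
  exact this.mono_left nhdsWithin_le_nhds

theorem LocallyConical.eventually_mem_iff {P : Set (Fin n → ℝ)} (hP : LocallyConical P)
    (q : Fin n → ℝ) : ∀ᶠ x in 𝓝 (0 : Fin n → ℝ), (x ∈ localCone P q ↔ q + x ∈ P) := by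
  obtain ⟨δ, hδ, h⟩ := hP q
  filter_upwards [Metric.ball_mem_nhds (0 : Fin n → ℝ) hδ] with x hx
  have hx' : ‖x‖ < δ := by simpa using hx
  have : ∀ᶠ ε in 𝓝[>] (0 : ℝ), (q + ε • x ∈ P ↔ q + x ∈ P) := by
    filter_upwards [Ioc_mem_nhdsGT (zero_lt_one' ℝ)] with t ht using (h x hx' t ht).symm
  exact (eventually_congr this).trans eventually_const

theorem isScalingInvariant_localCone (P : Set (Fin n → ℝ)) (q : Fin n → ℝ) :
    IsScalingInvariant (localCone P q) := by
  have key : ∀ r > (0 : ℝ), ∀ x, x ∈ localCone P q → r • x ∈ localCone P q := by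
    intro r hr x hx
    have ht : Tendsto (fun ε : ℝ => ε * r) (𝓝[>] 0) (𝓝[>] 0) := by
      refine tendsto_nhdsWithin_of_tendsto_nhds_of_eventually_within _ ?_ ?_
      · have : Tendsto (fun ε : ℝ => ε * r) (𝓝 0) (𝓝 (0 * r)) :=
          (continuous_id.mul continuous_const).tendsto 0
        rw [zero_mul] at this
        exact this.mono_left nhdsWithin_le_nhds
      · filter_upwards [self_mem_nhdsWithin] with ε hε using mul_pos hε hr
    have := ht.eventually hx
    simpa only [localCone, mem_ofPred_eq, smul_smul] using this
  intro r hr x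
  refine ⟨fun h => ?_, key r hr x⟩
  have := key r⁻¹ (inv_pos.2 hr) _ h
  rwa [smul_smul, inv_mul_cancel₀ hr.ne', one_smul] at this

theorem zero_mem_localCone {P : Set (Fin n → ℝ)} {q : Fin n → ℝ} :
    0 ∈ localCone P q ↔ q ∈ P := by simp [localCone]

theorem IsScalingInvariant.localCone_zero {C : Set (Fin n → ℝ)} (hC : IsScalingInvariant C) :
    localCone C 0 = C := by
  ext x
  have : ∀ᶠ ε in 𝓝[>] (0 : ℝ), ((0 : Fin n → ℝ) + ε • x ∈ C ↔ x ∈ C) := by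
    filter_upwards [self_mem_nhdsWithin] with ε hε
    rw [zero_add, hC ε hε]
  exact (eventually_congr this).trans eventually_const

theorem IsScalingInvariant.localCone_smul {C : Set (Fin n → ℝ)} (hC : IsScalingInvariant C)
    {r : ℝ} (hr : 0 < r) (x : Fin n → ℝ) : localCone C (r • x) = localCone C x := by
  ext y
  rw [← isScalingInvariant_localCone C (r • x) r hr]
  simp only [localCone, mem_ofPred_eq]
  refine eventually_congr (Eventually.of_forall fun ε => ?_)
  rw [smul_comm ε r y, ← smul_add, hC r hr]

theorem IsScalingInvariant.localCone_of_mem_lineality {C : Set (Fin n → ℝ)}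
    (hC : IsScalingInvariant C) {x : Fin n → ℝ} (hx : x ∈ lineality C) : localCone C x = C := by
  conv_rhs => rw [← hC.localCone_zero]
  ext y
  simp only [localCone, mem_ofPred_eq, zero_add]
  refine eventually_congr (Eventually.of_forall fun ε => ?_)
  have := hx 1 (ε • y)
  rwa [one_smul, add_comm] at this

theorem lineality_le_localCone (C : Set (Fin n → ℝ)) (x : Fin n → ℝ) :
    lineality C ≤ lineality (localCone C x) := by
  intro v hv r y
  simp only [localCone, mem_ofPred_eq]
  refine eventually_congr (Eventually.of_forall fun ε => ?_)
  rw [smul_add, ← add_assoc, smul_smul, hv]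

theorem LocallyConical.eventually_localCone {P : Set (Fin n → ℝ)} (hP : LocallyConical P)
    (q : Fin n → ℝ) :
    ∀ᶠ x in 𝓝 (0 : Fin n → ℝ), localCone (localCone P q) x = localCone P (q + x) := by
  have h := (hP.eventually_mem_iff q).eventually_nhds
  filter_upwards [h] with x hx
  ext y
  simp only [localCone, mem_ofPred_eq]
  refine eventually_congr ?_
  have ht : Tendsto (fun ε : ℝ => x + ε • y) (𝓝[>] 0) (𝓝 x) := by
    simpa using (tendsto_const_nhds (x := x)).add (tendsto_smul_zero y)
  filter_upwards [ht.eventually hx] with ε hε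
  rw [add_assoc]
  exact hε

theorem LocallyConical.tangent {P : Set (Fin n → ℝ)} (hP : LocallyConical P)
    (q : Fin n → ℝ) : LocallyConical (localCone P q) := by
  intro x
  have h := (tendsto_smul_zero x).eventually (hP.eventually_mem_iff q).eventually_nhds
  obtain ⟨r, hr, hr0⟩ := (h.and self_mem_nhdsWithin).exists
  have hr0 : 0 < r := hr0
  obtain ⟨η, hη, H⟩ := hP (q + r • x)
  obtain ⟨ρ, hρ, K⟩ := Metric.eventually_nhds_iff.1 hr
  refine ⟨min η ρ / r, by positivity, fun y hy t ht => ?_⟩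
  have hy : ‖r • y‖ < min η ρ := by
    rw [norm_smul, Real.norm_eq_abs, abs_of_pos hr0, mul_comm]
    exact (lt_div_iff₀ hr0).1 hy
  have hty : ‖t • r • y‖ < min η ρ := by
    rw [norm_smul, Real.norm_eq_abs, abs_of_pos ht.1]
    exact (mul_le_of_le_one_left (norm_nonneg _) ht.2).trans_lt hy
  rw [← isScalingInvariant_localCone P q r hr0 (x + y),
    ← isScalingInvariant_localCone P q r hr0 (x + t • y), smul_add, smul_add, smul_comm r t y,
    K (by simpa using hy.trans_le (min_le_right _ _)),
    K (by simpa using hty.trans_le (min_le_right _ _)), ← add_assoc, ← add_assoc]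
  exact H _ (hy.trans_le (min_le_left _ _)) t ht

/-- Moving away from `x` along the ray through `x` does not change what a cone looks like. -/
theorem LocallyConical.self_mem_lineality {C : Set (Fin n → ℝ)} (hL : LocallyConical C)
    (hC : IsScalingInvariant C) (x : Fin n → ℝ) : x ∈ lineality (localCone C x) := by
  intro r y
  have hD := isScalingInvariant_localCone C x
  have h0 : Tendsto (fun ε : ℝ => 1 + ε * r) (𝓝 0) (𝓝 1) := by
    have : Continuous fun ε : ℝ => 1 + ε * r := by fun_prop
    simpa using this.tendsto 0
  have hpos : ∀ᶠ ε in 𝓝[>] (0 : ℝ), 0 < 1 + ε * r :=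
    (h0.eventually_const_lt one_pos).filter_mono nhdsWithin_le_nhds
  have ht : Tendsto (fun ε : ℝ => (ε / (1 + ε * r)) • y) (𝓝[>] 0) (𝓝 0) := by
    have h1 : Tendsto (fun ε : ℝ => ε / (1 + ε * r)) (𝓝 0) (𝓝 (0 / 1)) :=
      tendsto_id.div h0 one_ne_zero
    have := (h1.mono_left (nhdsWithin_le_nhds (s := Ioi 0))).smul_const y
    simpa using this
  have e1 := (tendsto_smul_zero (y + r • x)).eventually (hL.eventually_mem_iff x)
  have e2 := ht.eventually (hL.eventually_mem_iff x)
  obtain ⟨ε, ⟨⟨h1, h2⟩, h3⟩, h4⟩ := (((e1.and e2).and hpos).and self_mem_nhdsWithin).exists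
  have h4 : 0 < ε := h4
  rw [← hD ε h4, h1, ← hD (ε / (1 + ε * r)) (div_pos h4 h3) y, h2, ← hC (1 + ε * r) h3 (x + (ε / (1 + ε * r)) • y)]
  congr! 1
  have e : (1 + ε * r) * (ε / (1 + ε * r)) = ε := by field_simp
  rw [smul_add (1 + ε * r), smul_smul (1 + ε * r), e, add_smul, one_smul, smul_add, smul_smul]
  abel

/-- Along the half-open segment from `x` to `y`, excluding `y`, membership in the cone is locally
constant as soon as the cone is locally invariant in the direction `y`; hence membership of `x` can
be read off at `y`. -/
theorem LocallyConical.mem_iff_mem_localCone {C : Set (Fin n → ℝ)} (hL : LocallyConical C)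
    (hC : IsScalingInvariant C) {x y : Fin n → ℝ}
    (h : ∀ t ∈ Ioc (0 : ℝ) 1, y ∈ lineality (localCone C (y + t • (x - y)))) :
    x ∈ C ↔ x ∈ localCone C y := by
  classical
  set f : ℝ → Bool := fun t => decide (y + t • (x - y) ∈ C) with hf
  have hcont : ContinuousOn f (Ioc 0 1) := by
    intro t ht
    refine ContinuousAt.continuousWithinAt ?_
    set w := y + t • (x - y) with hw
    have hdir : x - y ∈ lineality (localCone C w) := by
      have : x - y = t⁻¹ • (w - y) := by
        rw [hw, add_sub_cancel_left, smul_smul, inv_mul_cancel₀ ht.1.ne', one_smul]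
      rw [this]
      exact Submodule.smul_mem _ _ (Submodule.sub_mem _ (hL.self_mem_lineality hC w) (h t ht))
    have htend : Tendsto (fun s : ℝ => (s - t) • (x - y)) (𝓝 t) (𝓝 0) := by
      have : Continuous fun s : ℝ => (s - t) • (x - y) := by fun_prop
      simpa using this.tendsto t
    refine tendsto_nhds_of_eventually_eq ?_
    filter_upwards [htend.eventually (hL.eventually_mem_iff w)] with s hs
    have e : y + s • (x - y) = w + (s - t) • (x - y) := by rw [hw, sub_smul]; abel
    simp only [hf, e, decide_eq_decide]
    rw [← hs, ← hw, ← zero_mem_localCone (P := C) (q := w)]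
    have := hdir (s - t) 0
    rwa [zero_add] at this
  have hconst : ∀ t ∈ Ioc (0 : ℝ) 1, (y + t • (x - y) ∈ C ↔ x ∈ C) := by
    intro t ht
    have := isPreconnected_Ioc.constant hcont ht (right_mem_Ioc.2 one_pos)
    simpa [hf] using this
  have e1 := (tendsto_smul_zero (x - y)).eventually (hL.eventually_mem_iff y)
  obtain ⟨ε, h1, h2⟩ := (e1.and (Ioc_mem_nhdsGT (zero_lt_one' ℝ))).exists
  rw [← hconst ε h2, ← h1, isScalingInvariant_localCone C y ε h2.1]
  have := hL.self_mem_lineality hC y 1 (x - y)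
  rw [one_smul, sub_add_cancel] at this
  exact this.symm

end tangent

/-! ### Components, their vector spaces and their incidence -/

section components

variable {n : ℕ}

theorem unitCube_mem_nhds_zero : unitCube n ∈ 𝓝 (0 : Fin n → ℝ) := by
  have : unitCube n = Set.pi univ fun _ => Icc (-(1 / 2) : ℝ) (1 / 2) := by
    ext x; simp only [unitCube, mem_ofPred_eq, mem_univ_pi]
  rw [this]
  exact set_pi_mem_nhds finite_univ fun i _ => Icc_mem_nhds (by norm_num) (by norm_num)

theorem convex_unitCube : Convex ℝ (unitCube n) := by
  have : unitCube n = Set.pi univ fun _ => Icc (-(1 / 2) : ℝ) (1 / 2) := by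
    ext x; simp only [unitCube, mem_ofPred_eq, mem_univ_pi]
  rw [this]
  exact convex_pi fun i _ => convex_Icc _ _

theorem component_eq_inter (P : Set (Fin n → ℝ)) (v : Fin n → ℝ) :
    component P v = unitCube n ∩ localCone P v := rfl

theorem IsScalingInvariant.subset_of_inter_unitCube_eq {C D : Set (Fin n → ℝ)}
    (hC : IsScalingInvariant C) (hD : IsScalingInvariant D)
    (h : unitCube n ∩ C = unitCube n ∩ D) : C ⊆ D := by
  intro x hx
  obtain ⟨r, h1, h2⟩ :=
    (((tendsto_smul_zero x).eventually unitCube_mem_nhds_zero).and self_mem_nhdsWithin).exists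
  have : r • x ∈ unitCube n ∩ C := ⟨h1, (hC r h2 x).2 hx⟩
  rw [h] at this
  exact (hD r h2 x).1 this.2

/-- A component and the tangent cone of which it is the trace determine each other. -/
theorem component_eq_component_iff {P P' : Set (Fin n → ℝ)} {v v' : Fin n → ℝ} :
    component P v = component P' v' ↔ localCone P v = localCone P' v' := by
  refine ⟨fun h => ?_, fun h => by rw [component_eq_inter, h, ← component_eq_inter]⟩
  have h1 := isScalingInvariant_localCone P v
  have h2 := isScalingInvariant_localCone P' v'
  exact (h1.subset_of_inter_unitCube_eq h2 h).antisymm (h2.subset_of_inter_unitCube_eq h1 h.symm)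

/-- The apexes of the trace of a cone on the cube are the vectors of the cube that lie in the
lineality space of the cone. -/
theorem IsScalingInvariant.conicalIn_unitCube_iff {C : Set (Fin n → ℝ)}
    (hC : IsScalingInvariant C) {v : Fin n → ℝ} :
    ConicalIn (unitCube n ∩ C) (unitCube n) v ↔ v ∈ unitCube n ∧ v ∈ lineality C := by
  refine and_congr_right fun hv => ⟨fun h => ?_, fun h x hx t ht => ?_⟩
  · have pos : ∀ r > (0 : ℝ), ∀ x, x + r • v ∈ C ↔ x ∈ C := by
      intro r hr x
      -- With `t = 1 / (1 + r ε)`, the point `t (ε x - v) + v` is a multiple of `x + r v`.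
      obtain ⟨ε, h1, h2⟩ := (((tendsto_smul_zero x).eventually unitCube_mem_nhds_zero).and
        self_mem_nhdsWithin).exists
      have h2 : 0 < ε := h2
      have hpos : 0 < 1 + r * ε := by positivity
      have ht : 1 / (1 + r * ε) ∈ Ioo (0 : ℝ) 1 :=
        ⟨by positivity, (div_lt_one hpos).2 (lt_add_of_pos_right _ (by positivity))⟩
      have key := h _ h1 _ ht
      have e : (1 / (1 + r * ε)) • (ε • x - v) + v = (ε / (1 + r * ε)) • (x + r • v) := by
        ext i
        simp only [Pi.add_apply, Pi.smul_apply, Pi.sub_apply, smul_eq_mul]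
        field_simp
        ring
      have hmem : (ε / (1 + r * ε)) • (x + r • v) ∈ unitCube n := by
        rw [← e]
        have := convex_unitCube h1 hv ht.1.le (sub_nonneg.2 ht.2.le) (by ring)
        convert! this using 1
        rw [smul_sub, sub_smul, one_smul]
        abel
      rw [e] at key
      have key' : ε • x ∈ C ↔ (ε / (1 + r * ε)) • (x + r • v) ∈ C :=
        ⟨fun hx => (key.1 ⟨h1, hx⟩).2, fun hx => (key.2 ⟨hmem, hx⟩).2⟩
      rw [hC ε h2, hC _ (by positivity)] at key'
      exact key'.symm
    intro r x
    rcases lt_trichotomy r 0 with hr | rfl | hr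
    · have := pos (-r) (neg_pos.2 hr) (x + r • v)
      rw [neg_smul, add_neg_cancel_right] at this
      exact this.symm
    · simp
    · exact pos r hr x
  · have e : t • (x - v) + v = t • x + (1 - t) • v := by
      rw [smul_sub, sub_smul, one_smul]; abel
    have hmem : t • x + (1 - t) • v ∈ unitCube n :=
      convex_unitCube hx hv ht.1.le (sub_nonneg.2 ht.2.le) (by ring)
    rw [e, mem_inter_iff, mem_inter_iff, h, hC t ht.1]
    simp only [hx, hmem, true_and]

theorem componentSpace_component (P : Set (Fin n → ℝ)) (v : Fin n → ℝ) :
    componentSpace (component P v) = lineality (localCone P v) := by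
  have hC := isScalingInvariant_localCone P v
  unfold componentSpace
  simp only [component_eq_inter, hC.conicalIn_unitCube_iff]
  refine le_antisymm (Submodule.span_le.2 fun x hx => hx.2) fun x hx => ?_
  obtain ⟨r, h1, h2⟩ :=
    (((tendsto_smul_zero x).eventually unitCube_mem_nhds_zero).and self_mem_nhdsWithin).exists
  have h2 : 0 < r := h2
  have : r⁻¹ • r • x ∈ Submodule.span ℝ {v | v ∈ unitCube n ∧ v ∈ lineality (localCone P _)} :=
    Submodule.smul_mem _ _ (Submodule.subset_span ⟨h1, Submodule.smul_mem _ _ hx⟩)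
  rwa [smul_smul, inv_mul_cancel₀ h2.ne', one_smul] at this

theorem LocallyConical.eventually_component {P : Set (Fin n → ℝ)} (hP : LocallyConical P)
    (q : Fin n → ℝ) :
    ∀ᶠ x in 𝓝 (0 : Fin n → ℝ), component P (q + x) = component (localCone P q) x := by
  filter_upwards [hP.eventually_localCone q] with x hx
  rw [component_eq_component_iff, hx]

theorem Incident.exists_component_localCone {P Q₁ Q₂ : Set (Fin n → ℝ)} (hP : LocallyConical P)
    (h : Incident P Q₁ Q₂) {q : Fin n → ℝ} (hq : component P q = Q₁) :
    ∃ x, component (localCone P q) x = Q₂ := by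
  obtain ⟨ε, hε, H⟩ := Metric.eventually_nhds_iff.1 (hP.eventually_component q)
  obtain ⟨v, hv, hd⟩ := h.2.2.2 q hq ε hε
  refine ⟨v - q, ?_⟩
  rw [← H, add_sub_cancel, hv]
  rwa [dist_zero_right, norm_sub_rev]

/-- If the vector space did not grow, it would contain the displacement between the two points, which
would then have the same component. -/
theorem Incident.componentSpace_lt {P Q₁ Q₂ : Set (Fin n → ℝ)} (hP : LocallyConical P)
    (h : Incident P Q₁ Q₂) : componentSpace Q₁ < componentSpace Q₂ := by
  obtain ⟨q, hq⟩ := h.1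
  obtain ⟨x, hx⟩ := h.exists_component_localCone hP hq
  have hC := isScalingInvariant_localCone P q
  refine lt_of_le_of_ne ?_ fun heq => h.2.2.1 ?_
  · rw [← hq, ← hx, componentSpace_component, componentSpace_component]
    exact lineality_le_localCone _ _
  · rw [← hq, ← hx, componentSpace_component, componentSpace_component] at heq
    have hmem := (hP.tangent q).self_mem_lineality hC x
    rw [← heq] at hmem
    rw [← hq, ← hx, component_eq_component_iff, hC.localCone_of_mem_lineality hmem]

theorem Incident.trans {P Q₁ Q₂ Q₃ : Set (Fin n → ℝ)} (hP : LocallyConical P)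
    (h : Incident P Q₁ Q₂) (h' : Incident P Q₂ Q₃) : Incident P Q₁ Q₃ := by
  refine ⟨h.1, h'.2.1, ?_, fun v₁ hv₁ ε hε => ?_⟩
  · rintro rfl
    exact lt_asymm (h.componentSpace_lt hP) (h'.componentSpace_lt hP)
  · obtain ⟨v₂, hv₂, h₂⟩ := h.2.2.2 v₁ hv₁ (ε / 2) (half_pos hε)
    obtain ⟨v₃, hv₃, h₃⟩ := h'.2.2.2 v₂ hv₂ (ε / 2) (half_pos hε)
    refine ⟨v₃, hv₃, ?_⟩
    calc ‖v₁ - v₃‖ = ‖(v₁ - v₂) + (v₂ - v₃)‖ := by rw [sub_add_sub_cancel]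
      _ ≤ ‖v₁ - v₂‖ + ‖v₂ - v₃‖ := norm_add_le _ _
      _ < ε := by linarith

/-- The reflexive closure of the incidence relation. -/
def IncidentOrEq (P Q₁ Q₂ : Set (Fin n → ℝ)) : Prop := Q₁ = Q₂ ∨ Incident P Q₁ Q₂

theorem IncidentOrEq.trans {P Q₁ Q₂ Q₃ : Set (Fin n → ℝ)} (hP : LocallyConical P)
    (h : IncidentOrEq P Q₁ Q₂) (h' : IncidentOrEq P Q₂ Q₃) : IncidentOrEq P Q₁ Q₃ := by
  rcases h with rfl | h
  · exact h'
  · rcases h' with rfl | h'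
    · exact Or.inr h
    · exact Or.inr (h.trans hP h')

theorem IncidentOrEq.antisymm {P Q₁ Q₂ : Set (Fin n → ℝ)} (hP : LocallyConical P)
    (h : IncidentOrEq P Q₁ Q₂) (h' : IncidentOrEq P Q₂ Q₁) : Q₁ = Q₂ := by
  rcases h with rfl | h
  · rfl
  · rcases h' with rfl | h'
    · rfl
    · exact absurd (h.componentSpace_lt hP) (lt_asymm (h'.componentSpace_lt hP))

theorem IncidentOrEq.componentSpace_le {P Q₁ Q₂ : Set (Fin n → ℝ)} (hP : LocallyConical P)
    (h : IncidentOrEq P Q₁ Q₂) : componentSpace Q₁ ≤ componentSpace Q₂ := by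
  rcases h with rfl | h
  · rfl
  · exact (h.componentSpace_lt hP).le

theorem incidentOrEq_of_mem_coveredComponents {P Q R Q' : Set (Fin n → ℝ)}
    (hQ : IsComponent P Q) (h : Q' ∈ coveredComponents P Q R) : IncidentOrEq P Q Q' := by
  by_cases hne : Q = Q'
  · exact Or.inl hne
  refine Or.inr ⟨hQ, ?_, hne, fun v hv ε hε => ?_⟩
  · obtain ⟨q, hq⟩ := hQ
    obtain ⟨x, -, -, hx⟩ := h q hq 1 one_pos
    exact ⟨_, hx⟩
  · obtain ⟨x, -, hx, hx'⟩ := h v hv ε hε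
    exact ⟨v + x, hx', by simpa using hx⟩

theorem coveredComponents_mono {P Q R R' : Set (Fin n → ℝ)} (h : R ⊆ R') :
    coveredComponents P Q R ⊆ coveredComponents P Q R' := by
  intro Q' hQ' q hq ε hε
  obtain ⟨x, hx, H⟩ := hQ' q hq ε hε
  exact ⟨x, h hx, H⟩

/-- The components that a region stable by scaling covers around a component are those of the
points of the region in the tangent cone. -/
theorem mem_coveredComponents_iff {P R Q' : Set (Fin n → ℝ)} (hP : LocallyConical P)
    (hR : ∀ r > (0 : ℝ), ∀ x ∈ R, r • x ∈ R) (q : Fin n → ℝ) :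
    Q' ∈ coveredComponents P (component P q) R ↔ ∃ x ∈ R, component (localCone P q) x = Q' := by
  constructor
  · intro h
    obtain ⟨ε, hε, H⟩ := Metric.eventually_nhds_iff.1 (hP.eventually_component q)
    obtain ⟨x, hx, hxε, hx'⟩ := h q rfl ε hε
    exact ⟨x, hx, by rw [← H (by simpa using hxε), hx']⟩
  · rintro ⟨x, hx, rfl⟩ q' hq' ε hε
    rw [component_eq_component_iff] at hq'
    have e1 := (tendsto_smul_zero x).eventually (hP.eventually_component q')
    have e2 := (tendsto_smul_zero x).eventually (Metric.ball_mem_nhds 0 hε)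
    obtain ⟨r, ⟨h1, h2⟩, h3⟩ := ((e1.and e2).and self_mem_nhdsWithin).exists
    refine ⟨r • x, hR r h3 x hx, by simpa using h2, ?_⟩
    rw [h1, component_eq_component_iff, hq',
      (isScalingInvariant_localCone P q).localCone_smul h3]

theorem IsUniqueMinimal.eq {P Q₁ Q₂ : Set (Fin n → ℝ)} {U : Set (Set (Fin n → ℝ))}
    (h₁ : IsUniqueMinimal P U Q₁) (h₂ : IsUniqueMinimal P U Q₂) : Q₁ = Q₂ :=
  (h₂ Q₁).1 ((h₁ Q₁).2 rfl)

theorem IsUniqueMinimal.mem {P Q : Set (Fin n → ℝ)} {U : Set (Set (Fin n → ℝ))}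
    (h : IsUniqueMinimal P U Q) : Q ∈ U := ((h Q).2 rfl).1

/-- A unique minimal element is a least element, because there is no infinite descent: the dimension
of the vector space decreases. -/
theorem IsUniqueMinimal.incidentOrEq {P Q Q' : Set (Fin n → ℝ)} {U : Set (Set (Fin n → ℝ))}
    (hP : LocallyConical P) (h : IsUniqueMinimal P U Q) (hQ' : Q' ∈ U) : IncidentOrEq P Q Q' := by
  induction hd : Module.finrank ℝ (componentSpace Q') using Nat.strong_induction_on
    generalizing Q' with
  | _ d ih =>
    by_cases hmin : ∀ Q'' ∈ U, ¬ Incident P Q'' Q'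
    · exact Or.inl ((h Q').1 ⟨hQ', hmin⟩).symm
    · push Not at hmin
      obtain ⟨Q'', hQ'', hinc⟩ := hmin
      exact (ih _ (hd ▸ Submodule.finrank_lt_finrank_of_lt (hinc.componentSpace_lt hP))
        hQ'' rfl).trans hP (Or.inr hinc)

/-- If a region `R` is convex up to scaling, and covers a unique minimal component around a
component, then the tangent cones of these two components have the same trace on `R`. -/
theorem IsUniqueMinimal.mem_localCone_iff {P R : Set (Fin n → ℝ)} (hP : LocallyConical P)
    (hR : ∀ r > (0 : ℝ), ∀ x ∈ R, r • x ∈ R)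
    (hconv : ∀ x ∈ R, ∀ y ∈ R, ∃ r > (0 : ℝ), ∃ s > (0 : ℝ), ∀ t ∈ Icc (0 : ℝ) 1,
      s • y + t • (r • x - s • y) ∈ R)
    {q q' : Fin n → ℝ}
    (h : IsUniqueMinimal P (coveredComponents P (component P q) R) (component P q'))
    {x : Fin n → ℝ} (hx : x ∈ R) : x ∈ localCone P q ↔ x ∈ localCone P q' := by
  obtain ⟨y, hy, hyq⟩ := (mem_coveredComponents_iff hP hR q).1 h.mem
  obtain ⟨r, hr, s, hs, hseg⟩ := hconv x hx y hy
  have hC := isScalingInvariant_localCone P q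
  have hL := hP.tangent q
  have hyq' : localCone (localCone P q) (s • y) = localCone P q' := by
    rw [hC.localCone_smul hs, ← component_eq_component_iff, hyq]
  rw [← hC r hr, hL.mem_iff_mem_localCone hC (y := s • y), hyq',
    isScalingInvariant_localCone P q' r hr]
  intro t ht
  have hle := (h.incidentOrEq hP ((mem_coveredComponents_iff hP hR q).2
    ⟨_, hseg t ⟨ht.1.le, ht.2⟩, rfl⟩)).componentSpace_le hP
  rw [componentSpace_component, componentSpace_component, ← hyq'] at hle
  exact hle (hL.self_mem_lineality hC _)

end components

/-! ### Binary expansions -/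

section binary

/-- `β` is the sequence of the fractional binary digits of `x`. -/
def IsBinaryExpansion (β : ℕ → Bool) (x : ℝ) : Prop :=
  HasSum (fun k : ℕ => ((β k).toNat : ℝ) / 2 ^ (k + 1)) x

theorem exists_isBinaryExpansion {x : ℝ} (hx : x ∈ Icc (0 : ℝ) 1) :
    ∃ β, IsBinaryExpansion β x := by
  obtain ⟨d, -, hd⟩ := Real.ofDigits_SurjOn (b := 2) one_lt_two hx
  refine ⟨fun k => decide (d k = 1), ?_⟩
  have := (Real.summable_ofDigitsTerm (digits := d)).hasSum
  rw [show ∑' i, Real.ofDigitsTerm d i = x from hd] at this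
  unfold IsBinaryExpansion
  convert! this using 2 with k
  rw [Real.ofDigitsTerm, div_eq_mul_inv]
  have : ∀ e : Fin 2, ((decide (e = 1)).toNat : ℝ) = (e : ℕ) := by
    intro e; fin_cases e <;> simp
  rw [this]
  norm_num

theorem IsBinaryExpansion.mem_Icc {β : ℕ → Bool} {x : ℝ} (h : IsBinaryExpansion β x) :
    x ∈ Icc (0 : ℝ) 1 := by
  have hg : HasSum (fun k : ℕ => (1 : ℝ) / 2 ^ (k + 1)) 1 := by
    convert! hasSum_geometric_two' (1 : ℝ) using 2 with k
    rw [pow_succ', div_div]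
  refine ⟨h.nonneg fun k => by positivity, hasSum_le (fun k => ?_) h hg⟩
  gcongr
  exact_mod_cast Bool.toNat_le (β k)

theorem isBinaryExpansion_succ {β : ℕ → Bool} {x : ℝ} :
    IsBinaryExpansion (fun k => β (k + 1)) (2 * x - (β 0).toNat) ↔ IsBinaryExpansion β x := by
  unfold IsBinaryExpansion
  rw [← hasSum_nat_add_iff' (f := fun k : ℕ => ((β k).toNat : ℝ) / 2 ^ (k + 1)) 1,
    ← hasSum_mul_left_iff (f := fun k : ℕ => ((β (k + 1)).toNat : ℝ) / 2 ^ (k + 1 + 1))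
      (two_ne_zero' ℝ)]
  simp only [Finset.sum_range_one, zero_add, pow_one]
  rw [show 2 * (x - ((β 0).toNat : ℝ) / 2) = 2 * x - (β 0).toNat by ring]
  refine iff_of_eq ?_
  congr 1
  funext k
  rw [pow_succ _ (k + 1)]
  field_simp

theorem IsBinaryExpansion.exists_convexComb {m : ℕ} {α β : ℕ → Bool} {a b t : ℝ}
    (hα : IsBinaryExpansion α a) (hβ : IsBinaryExpansion β b) (ht : t ∈ Icc (0 : ℝ) 1)
    (h : ∀ k < m, α k = β k) :
    ∃ γ, IsBinaryExpansion γ (b + t * (a - b)) ∧ ∀ k < m, γ k = α k := by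
  induction m generalizing α β a b with
  | zero =>
    have hmem : b + t * (a - b) ∈ Icc (0 : ℝ) 1 := by
      have := convex_Icc (0 : ℝ) 1 hα.mem_Icc hβ.mem_Icc ht.1 (sub_nonneg.2 ht.2) (by ring)
      simp only [smul_eq_mul] at this
      convert! this using 1
      ring
    obtain ⟨γ, hγ⟩ := exists_isBinaryExpansion hmem
    exact ⟨γ, hγ, by simp⟩
  | succ m ih =>
    obtain ⟨γ, hγ, hγ'⟩ := ih (isBinaryExpansion_succ.2 hα) (isBinaryExpansion_succ.2 hβ)
      fun k hk => h (k + 1) (Nat.succ_lt_succ hk)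
    refine ⟨fun k => Nat.casesOn k (α 0) γ, isBinaryExpansion_succ.1 ?_, ?_⟩
    · convert! hγ using 1
      rw [← h 0 m.succ_pos]
      change 2 * (b + t * (a - b)) - ((α 0).toNat : ℝ) = _
      ring
    · rintro (_ | k) hk
      · rfl
      · exact hγ' k (Nat.lt_of_succ_lt_succ hk)

/-- The numbers that have an expansion with a given prefix form an interval: a convex combination
of two numbers keeps the common prefix of their expansions. -/
theorem IsBinaryExpansion.exists_convexComb_commonPrefix {α β : ℕ → Bool} {a b t : ℝ}
    (hα : IsBinaryExpansion α a) (hβ : IsBinaryExpansion β b) (ht : t ∈ Icc (0 : ℝ) 1) :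
    ∃ γ, IsBinaryExpansion γ (b + t * (a - b)) ∧
      ∀ k, (∀ l ≤ k, α l = β l) → γ k = α k := by
  by_cases hall : ∀ k, α k = β k
  · have : α = β := funext hall
    subst this
    refine ⟨α, ?_, fun _ _ => rfl⟩
    rw [hα.unique hβ]
    simpa using hβ
  · push Not at hall
    classical
    obtain ⟨γ, hγ, hγ'⟩ := hα.exists_convexComb hβ ht (m := Nat.find hall)
      fun k hk => not_not.1 (Nat.find_min hall hk)
    refine ⟨γ, hγ, fun k hk => hγ' k ?_⟩
    by_contra hlt
    exact Nat.find_spec hall (hk _ (not_lt.1 hlt))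

end binary

/-! ### Encodings of vectors and prefix regions -/

section encodings

variable {n : ℕ}

/-- The sum of `W` and of the first `k` coordinate axes. -/
def supAxes (W : Submodule ℝ (Fin n → ℝ)) (k : ℕ) : Submodule ℝ (Fin n → ℝ) :=
  W ⊔ Submodule.span ℝ {x | ∃ j : Fin n, (j : ℕ) < k ∧ x = Pi.single j 1}

theorem supAxes_succ (W : Submodule ℝ (Fin n → ℝ)) (i : Fin n) :
    supAxes W (i + 1) = supAxes W i ⊔ Submodule.span ℝ {Pi.single i 1} := by
  rw [supAxes, supAxes, sup_assoc, ← Submodule.span_union]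
  congr 2
  ext x
  simp only [mem_ofPred_eq, mem_union, mem_singleton_iff, Nat.lt_succ_iff_lt_or_eq, or_and_right,
    exists_or]
  refine or_congr_right ⟨?_, fun h => ⟨i, rfl, h⟩⟩
  rintro ⟨j, hj, rfl⟩
  rw [Fin.ext hj]

theorem supAxes_last (W : Submodule ℝ (Fin n → ℝ)) : supAxes W n = ⊤ := by
  rw [eq_top_iff]
  refine le_trans ?_ le_sup_right
  rw [← (Pi.basisFun ℝ (Fin n)).span_eq]
  refine Submodule.span_mono ?_
  rintro _ ⟨j, rfl⟩
  exact ⟨j, j.2, Pi.basisFun_apply _ _ _⟩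

theorem mem_complIndices {W : Submodule ℝ (Fin n → ℝ)} {i : Fin n} :
    i ∈ complIndices W ↔ (Pi.single i 1 : Fin n → ℝ) ∉ supAxes W i := by
  simp only [complIndices, Finset.mem_filter, Finset.mem_univ, true_and]
  rfl

/-- Greedy selection: an axis is selected exactly when it increases the dimension. -/
theorem finrank_supAxes (W : Submodule ℝ (Fin n → ℝ)) {k : ℕ} (hk : k ≤ n) :
    Module.finrank ℝ (supAxes W k) =
      Module.finrank ℝ W + ((complIndices W).filter fun j : Fin n => (j : ℕ) < k).card := by
  induction k with
  | zero =>
    have : supAxes W 0 = W := by simp [supAxes]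
    rw [this]
    simp
  | succ k ih =>
    have ih := ih (Nat.le_of_succ_le hk)
    have hs := supAxes_succ W ⟨k, hk⟩
    have hi := mem_complIndices (W := W) (i := ⟨k, hk⟩)
    simp only at hs hi
    have hfilter : ((complIndices W).filter fun j : Fin n => (j : ℕ) < k + 1) =
        ((complIndices W).filter fun j : Fin n => (j : ℕ) < k) ∪
          (complIndices W).filter fun j : Fin n => j = ⟨k, hk⟩ := by
      rw [← Finset.filter_or]
      refine Finset.filter_congr fun j _ => ?_
      rw [Nat.lt_succ_iff_lt_or_eq, Fin.ext_iff]
    by_cases h : (⟨k, hk⟩ : Fin n) ∈ complIndices W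
    · rw [hs, Submodule.finrank_sup_span_singleton (hi.1 h), ih, hfilter, Finset.filter_eq', if_pos h,
        Finset.card_union_of_disjoint (by simp), Finset.card_singleton, add_assoc]
    · rw [hs, sup_eq_left.2, ih, hfilter, Finset.filter_eq', if_neg h, Finset.union_empty]
      rw [Submodule.span_singleton_le_iff_mem]
      exact not_not.1 fun h' => h (hi.2 h')

theorem card_complIndices (W : Submodule ℝ (Fin n → ℝ)) :
    (complIndices W).card = n - Module.finrank ℝ W := by
  have h := finrank_supAxes W le_rfl
  rw [supAxes_last, finrank_top, Module.finrank_fin_fun, Finset.filter_true_of_mem fun (j : Fin n) _ => j.2]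
    at h
  omega

theorem supAxes_le_sup_span_complVector (W : Submodule ℝ (Fin n → ℝ)) {k : ℕ} (hk : k ≤ n) :
    supAxes W k ≤ W ⊔ Submodule.span ℝ (range (complVector W)) := by
  induction k with
  | zero => simp [supAxes]
  | succ k ih =>
    have hs := supAxes_succ W ⟨k, hk⟩
    simp only at hs
    rw [hs, sup_le_iff, Submodule.span_singleton_le_iff_mem]
    refine ⟨ih (Nat.le_of_succ_le hk), ?_⟩
    by_cases h : (⟨k, hk⟩ : Fin n) ∈ complIndices W
    · refine Submodule.mem_sup_right (Submodule.subset_span ?_)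
      have : (⟨k, hk⟩ : Fin n) ∈ range ((complIndices W).orderEmbOfFin rfl) := by
        rw [Finset.range_orderEmbOfFin]; exact h
      obtain ⟨l, hl⟩ := this
      exact ⟨l, by rw [complVector, hl]⟩
    · exact ih (Nat.le_of_succ_le hk) (not_not.1 fun h' => h (mem_complIndices.2 h'))

theorem exists_isComplCoord (W : Submodule ℝ (Fin n → ℝ)) (v : Fin n → ℝ) :
    ∃ z, IsComplCoord W v z := by
  have hv : v ∈ W ⊔ Submodule.span ℝ (range (complVector W)) := by
    refine supAxes_le_sup_span_complVector W le_rfl ?_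
    rw [supAxes_last]
    trivial
  obtain ⟨w, hw, u, hu, rfl⟩ := Submodule.mem_sup.1 hv
  obtain ⟨z, rfl⟩ := (Submodule.mem_span_range_iff_exists_fun ℝ).1 hu
  exact ⟨z, by rwa [IsComplCoord, add_sub_cancel_right]⟩

theorem IsComplCoord.smul {W : Submodule ℝ (Fin n → ℝ)} {v : Fin n → ℝ}
    {z : Fin (complIndices W).card → ℝ} (h : IsComplCoord W v z) (r : ℝ) :
    IsComplCoord W (r • v) (r • z) := by
  have := W.smul_mem r h
  rw [smul_sub, Finset.smul_sum] at this
  simpa only [IsComplCoord, Pi.smul_apply, smul_assoc] using this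

theorem IsComplCoord.add {W : Submodule ℝ (Fin n → ℝ)} {v v' : Fin n → ℝ}
    {z z' : Fin (complIndices W).card → ℝ} (h : IsComplCoord W v z) (h' : IsComplCoord W v' z') :
    IsComplCoord W (v + v') (z + z') := by
  have := W.add_mem h h'
  simp only [IsComplCoord, Pi.add_apply, add_smul, Finset.sum_add_distrib]
  convert! this using 1
  abel

theorem normalizedForm_smul {d : ℕ} (z : Fin d → ℝ) {r : ℝ} (hr : 0 < r) :
    normalizedForm (r • z) = normalizedForm z := by
  rw [normalizedForm, normalizedForm, norm_smul, smul_smul, Real.norm_eq_abs, abs_of_pos hr]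
  congr 1
  field_simp

theorem abs_normalizedForm_le {d : ℕ} (z : Fin d → ℝ) (j : Fin d) :
    |normalizedForm z j| ≤ 1 / 2 := by
  by_cases hz : z = 0
  · simp [hz, normalizedForm]
  have hz : 0 < ‖z‖ := norm_pos_iff.2 hz
  rw [normalizedForm, Pi.smul_apply, smul_eq_mul, abs_mul, abs_of_pos (by positivity),
    ← Real.norm_eq_abs (z j)]
  calc 1 / (2 * ‖z‖) * ‖z j‖ ≤ 1 / (2 * ‖z‖) * ‖z‖ := by gcongr; exact norm_le_pi_norm z j
    _ = 1 / 2 := by field_simp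

theorem normalizedForm_eq_self {d : ℕ} {z : Fin d → ℝ} (hz : ‖z‖ = 1 / 2) :
    normalizedForm z = z := by
  rw [normalizedForm, hz]
  norm_num

theorem posWithout_lt {d : ℕ} {i j : Fin d} (h : j ≠ i) : posWithout i j < d - 1 := by
  have := i.2
  have := j.2
  rw [Ne, Fin.ext_iff] at h
  unfold posWithout
  split_ifs with hlt <;> simp only [Fin.lt_def] at hlt <;> omega

theorem posWithout_injective {d : ℕ} {i j j' : Fin d} (h : j ≠ i) (h' : j' ≠ i)
    (heq : posWithout i j = posWithout i j') : j = j' := by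
  rw [Ne, Fin.ext_iff] at h h'
  rw [Fin.ext_iff]
  unfold posWithout at heq
  split_ifs at heq with h1 h2 h2 <;> simp only [Fin.lt_def] at h1 h2 <;> omega

/-- In a serialization, a position determines the index `j` of the component and the rank `k` of the
digit. -/
theorem serial_injective {d : ℕ} {i j j' : Fin d} (h : j ≠ i) (h' : j' ≠ i) {k k' : ℕ}
    (heq : k * (d - 1) + posWithout i j = k' * (d - 1) + posWithout i j') : j = j' ∧ k = k' := by
  have h1 := posWithout_lt h
  have h2 := posWithout_lt h'
  have hmod := congrArg (· % (d - 1)) heq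
  simp only [Nat.mul_add_mod_self_right, Nat.mod_eq_of_lt h1, Nat.mod_eq_of_lt h2] at hmod
  refine ⟨posWithout_injective h h' hmod, ?_⟩
  rw [hmod, add_left_inj] at heq
  exact Nat.eq_of_mul_eq_mul_right (by omega) heq

/-- Sequences indexed by the `j ≠ i` can be serialized, and agree with a given word at the first
`L` positions if each of them does. -/
theorem exists_serialization {d : ℕ} (i : Fin d) (f : Fin d → ℕ → Bool) (w₀ : ℕ → Bool) (L : ℕ)
    (h : ∀ j ≠ i, ∀ k, k * (d - 1) + posWithout i j < L →
      f j k = w₀ (k * (d - 1) + posWithout i j)) :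
    ∃ w : ℕ → Bool, (∀ m < L, w m = w₀ m) ∧
      ∀ j ≠ i, ∀ k, w (k * (d - 1) + posWithout i j) = f j k := by
  classical
  refine ⟨fun m => if hm : ∃ p : Fin d × ℕ, p.1 ≠ i ∧ p.2 * (d - 1) + posWithout i p.1 = m then
    f hm.choose.1 hm.choose.2 else w₀ m, fun m hmL => ?_, fun j hj k => ?_⟩
  · dsimp only
    split_ifs with hm
    · obtain ⟨h1, h2⟩ := hm.choose_spec
      rw [h _ h1 _ (by omega), h2]
    · rfl
  · have hm : ∃ p : Fin d × ℕ, p.1 ≠ i ∧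
        p.2 * (d - 1) + posWithout i p.1 = k * (d - 1) + posWithout i j := ⟨(j, k), hj, rfl⟩
    dsimp only
    rw [dif_pos hm]
    obtain ⟨h1, h2⟩ := hm.choose_spec
    obtain ⟨h3, h4⟩ := serial_injective h1 hj h2
    rw [h3, h4]

theorem exists_isEncoding {W : Submodule ℝ (Fin n → ℝ)} {v : Fin n → ℝ} (hv : v ∉ W) :
    ∃ a w, IsEncoding W v a w := by
  obtain ⟨z, hz⟩ := exists_isComplCoord W v
  have hz0 : z ≠ 0 := by
    rintro rfl
    simp only [IsComplCoord, Pi.zero_apply, zero_smul, Finset.sum_const_zero, sub_zero] at hz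
    exact hv hz
  have hpos : 0 < ‖z‖ := norm_pos_iff.2 hz0
  obtain ⟨i, hi⟩ : ∃ i, ‖z i‖ = ‖z‖ := by
    have : Nonempty (Fin (complIndices W).card) := by
      by_contra hne
      rw [not_nonempty_iff] at hne
      exact hz0 (Subsingleton.elim _ _)
    obtain ⟨i, -, hi⟩ := Finset.exists_mem_eq_sup' Finset.univ_nonempty fun j => ‖z j‖
    refine ⟨i, le_antisymm (norm_le_pi_norm z i) ((pi_norm_le_iff_of_nonneg (norm_nonneg _)).2 ?_)⟩
    exact fun j => hi ▸ Finset.le_sup' (fun j => ‖z j‖) (Finset.mem_univ j)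
  have hexp : ∀ j, ∃ β, IsBinaryExpansion β (normalizedForm z j + 1 / 2) := fun j => by
    have := abs_le.1 (abs_normalizedForm_le z j)
    exact exists_isBinaryExpansion ⟨by linarith, by linarith⟩
  choose f hf using hexp
  obtain ⟨w, -, hw⟩ := exists_serialization i f (fun _ => false) 0 (by simp)
  refine ⟨(decide (0 ≤ z i), i.1.succPNat), w, z, hz, hz0, i, rfl, ?_, fun j hj => ?_⟩
  · rw [normalizedForm, Pi.smul_apply, smul_eq_mul]
    rw [Real.norm_eq_abs] at hi
    by_cases h : 0 ≤ z i
    · rw [decide_eq_true h, if_pos rfl, ← hi, abs_of_nonneg h]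
      rw [← hi, abs_of_nonneg h] at hpos
      field_simp
    · rw [decide_eq_false h, if_neg Bool.false_ne_true, ← hi, abs_of_neg (not_le.1 h)]
      have : z i ≠ 0 := fun h0 => h h0.ge
      field_simp
  · simp only [hw j hj]
    exact hf j

theorem IsEncoding.le_codim {W : Submodule ℝ (Fin n → ℝ)} {v : Fin n → ℝ} {a : FaceSymbol}
    {w : ℕ → Bool} (h : IsEncoding W v a w) : (a.2 : ℕ) ≤ n - Module.finrank ℝ W := by
  obtain ⟨z, -, -, i, hi, -⟩ := h
  rw [← card_complIndices, ← hi]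
  exact i.2

theorem IsEncoding.mem_prefixRegion {W : Submodule ℝ (Fin n → ℝ)} {v : Fin n → ℝ} {a : FaceSymbol}
    {w : ℕ → Bool} (h : IsEncoding W v a w) (k : ℕ) :
    v ∈ prefixRegion W a (List.ofFn fun j : Fin k => w j) := by
  refine ⟨w, h, List.ext_getElem (by simp) fun m h1 h2 => by simp⟩

theorem prefixRegion_append_subset (W : Submodule ℝ (Fin n → ℝ)) (a : FaceSymbol)
    (u u' : List Bool) : prefixRegion W a (u ++ u') ⊆ prefixRegion W a u := by
  rintro v ⟨w, hw, h⟩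
  refine ⟨w, hw, List.ext_getElem (by simp) fun m h1 h2 => ?_⟩
  have := List.getElem_of_eq h (i := m) (by simp at h1 ⊢; omega)
  rw [List.getElem_append_left h2] at this
  rw [← this]
  simp

theorem smul_mem_prefixRegion {W : Submodule ℝ (Fin n → ℝ)} {a : FaceSymbol} {u : List Bool} :
    ∀ r > (0 : ℝ), ∀ x ∈ prefixRegion W a u, r • x ∈ prefixRegion W a u := by
  rintro r hr x ⟨w, ⟨z, hz, hz0, i, hi, hni, hj⟩, hu⟩
  refine ⟨w, ⟨r • z, hz.smul r, smul_ne_zero hr.ne' hz0, i, hi, ?_, ?_⟩, hu⟩ <;>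
    rwa [normalizedForm_smul z hr]

/-- The regions are convex up to scaling: once two vectors are normalized, they lie on the same face
of the cube, and so does the segment between them. -/
theorem segment_subset_prefixRegion {W : Submodule ℝ (Fin n → ℝ)} {a : FaceSymbol}
    {u : List Bool} : ∀ x ∈ prefixRegion W a u, ∀ y ∈ prefixRegion W a u,
      ∃ r > (0 : ℝ), ∃ s > (0 : ℝ), ∀ t ∈ Icc (0 : ℝ) 1,
        s • y + t • (r • x - s • y) ∈ prefixRegion W a u := by
  rintro x ⟨w, ⟨z, hz, hz0, i, hi, hni, hj⟩, hu⟩ y ⟨w', ⟨z', hz', hz0', i', hi', hni', hj'⟩, hu'⟩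
  obtain rfl : i = i' := Fin.ext (by omega)
  have hpos : 0 < ‖z‖ := norm_pos_iff.2 hz0
  have hpos' : 0 < ‖z'‖ := norm_pos_iff.2 hz0'
  refine ⟨1 / (2 * ‖z‖), by positivity, 1 / (2 * ‖z'‖), by positivity, fun t ht => ?_⟩
  set p := normalizedForm z with hp
  set p' := normalizedForm z' with hp'
  set c := p' + t • (p - p') with hc
  have hcoord : IsComplCoord W
      ((1 / (2 * ‖z'‖)) • y + t • ((1 / (2 * ‖z‖)) • x - (1 / (2 * ‖z'‖)) • y)) c := by
    have h1 : IsComplCoord W _ p := hz.smul (1 / (2 * ‖z‖))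
    have h2 : IsComplCoord W _ p' := hz'.smul (1 / (2 * ‖z'‖))
    have := h2.add ((h1.add (h2.smul (-1))).smul t)
    simpa only [neg_smul, one_smul, ← sub_eq_add_neg] using this
  have hcj : ∀ j, |c j| ≤ 1 / 2 := by
    intro j
    have h1 := abs_le.1 (abs_normalizedForm_le z j)
    have h2 := abs_le.1 (abs_normalizedForm_le z' j)
    have := convex_Icc (-(1 / 2) : ℝ) (1 / 2) h1 h2 ht.1 (sub_nonneg.2 ht.2) (by ring)
    rw [abs_le, ← mem_Icc]
    convert! this using 1
    simp only [hc, Pi.add_apply, Pi.smul_apply, Pi.sub_apply, smul_eq_mul]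
    ring
  have hci : c i = if a.1 then 1 / 2 else -(1 / 2) := by
    simp only [hc, Pi.add_apply, Pi.smul_apply, Pi.sub_apply, hni, hni']
    simp
  have hnorm : ‖c‖ = 1 / 2 := by
    refine le_antisymm ((pi_norm_le_iff_of_nonneg (by norm_num)).2 hcj) ?_
    refine le_trans ?_ (norm_le_pi_norm c i)
    rw [hci, Real.norm_eq_abs]
    split_ifs <;> norm_num [abs_of_pos]
  have hexp : ∀ j, ∃ γ : ℕ → Bool, j ≠ i → IsBinaryExpansion γ (c j + 1 / 2) ∧
      ∀ k, (∀ l ≤ k, w (l * ((complIndices W).card - 1) + posWithout i j) =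
        w' (l * ((complIndices W).card - 1) + posWithout i j)) →
        γ k = w (k * ((complIndices W).card - 1) + posWithout i j) := by
    intro j
    by_cases hji : j = i
    · exact ⟨fun _ => false, fun h => absurd hji h⟩
    obtain ⟨γ, hγ, hγ'⟩ := IsBinaryExpansion.exists_convexComb_commonPrefix
      (hj j hji) (hj' j hji) ht
    refine ⟨γ, fun _ => ⟨?_, hγ'⟩⟩
    convert! hγ using 1
    simp only [hc, Pi.add_apply, Pi.smul_apply, Pi.sub_apply, smul_eq_mul]
    ring
  choose f hf using hexp
  have hww : ∀ m < u.length, w m = w' m := by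
    intro m hm
    have h1 := List.getElem_of_eq hu (i := m) (by simpa using hm)
    have h2 := List.getElem_of_eq hu' (i := m) (by simpa using hm)
    simp only [List.getElem_ofFn] at h1 h2
    rw [h1, h2]
  obtain ⟨w'', hw1, hw2⟩ := exists_serialization i f w u.length fun j hji k hk => by
    refine (hf j hji).2 k fun l hl => hww _ (lt_of_le_of_lt ?_ hk)
    gcongr
  refine ⟨w'', ⟨c, hcoord, ?_, i, hi, ?_, fun j hji => ?_⟩, ?_⟩
  · rw [← norm_pos_iff, hnorm]; norm_num
  · rw [normalizedForm_eq_self hnorm, hci]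
  · rw [normalizedForm_eq_self hnorm]
    simp only [hw2 j hji]
    exact (hf j hji).1
  · conv_rhs => rw [← hu]
    congr 1
    funext k
    exact hw1 k k.2

end encodings

/-! ### Runs of an automaton -/

namespace IRVA

section runs

variable {n : ℕ} {SI SE : Type*} {A : IRVA n SI SE}

theorem readBits_append (x : SI ⊕ SE) (u u' : List Bool) :
    A.readBits x (u ++ u') = (A.readBits x u).bind fun y => A.readBits y u' := by
  induction u generalizing x with
  | nil => simp [readBits]
  | cons b u ih =>
    cases x with
    | inl s => simp [readBits]
    | inr e =>
      simp only [List.cons_append, readBits, Option.bind_assoc, ih]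

theorem read_append (s : SI) (a : FaceSymbol) (u u' : List Bool) :
    A.read s a (u ++ u') = (A.read s a u).bind fun y => A.readBits y u' := by
  simp only [read, readBits_append, Option.bind_assoc]

theorem readBits_inl {s : SI} {u : List Bool} {y : SI ⊕ SE}
    (h : A.readBits (Sum.inl s) u = some y) : u = [] ∧ y = Sum.inl s := by
  cases u with
  | nil => simpa [readBits, eq_comm] using h
  | cons b u => simp [readBits] at h

theorem reflTransGen_of_readBits {x y : SI ⊕ SE} {u : List Bool}
    (h : A.readBits x u = some y) : Relation.ReflTransGen A.Trans x y := by
  induction u generalizing x with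
  | nil =>
    obtain rfl : x = y := by simpa [readBits] using h
    exact .refl
  | cons b u ih =>
    cases x with
    | inl s => simp [readBits] at h
    | inr e =>
      obtain ⟨z, hz, hz'⟩ := Option.bind_eq_some_iff.1 h
      exact .head (.explicit e b z hz) (ih hz')

theorem reaches_of_read {s : SI} {a : FaceSymbol} {u : List Bool} {y : SI ⊕ SE}
    (h : A.read s a u = some y) : A.Reaches (Sum.inl s) y := by
  obtain ⟨z, hz, hz'⟩ := Option.bind_eq_some_iff.1 h
  exact .head' (.implicit s a z hz) (reflTransGen_of_readBits hz')

theorem read_nil (s : SI) (a : FaceSymbol) : A.read s a [] = A.stepI s a := by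
  cases h : A.stepI s a <;> simp [read, readBits, h]

/-- An explicit state from which a word leads to an implicit state `s` leads to an explicit state
with a transition to `s`. -/
theorem exists_explicit_trans {e : SE} {s : SI} {u : List Bool}
    (h : A.readBits (Sum.inr e) u = some (Sum.inl s)) :
    ∃ e', Relation.ReflTransGen A.Trans (Sum.inr e) (Sum.inr e') ∧
      A.Trans (Sum.inr e') (Sum.inl s) := by
  induction u generalizing e with
  | nil => simp [readBits] at h
  | cons b u ih =>
    obtain ⟨z, hz, hz'⟩ := Option.bind_eq_some_iff.1 h
    cases z with
    | inl t =>
      obtain ⟨-, h2⟩ := readBits_inl hz'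
      exact ⟨e, .refl, .explicit e b _ (h2 ▸ hz)⟩
    | inr e₁ =>
      obtain ⟨e', h1, h2⟩ := ih hz'
      exact ⟨e', .head (.explicit e b _ hz) h1, h2⟩

theorem exists_read_eq_explicit {s : SI} {e : SE} (h : A.Reaches (Sum.inl s) (Sum.inr e)) :
    ∃ t a u, A.read t a u = some (Sum.inr e) := by
  suffices key : ∀ y, A.Reaches (Sum.inl s) y → ∀ e, y = Sum.inr e →
      ∃ t a u, A.read t a u = some (Sum.inr e) from key _ h e rfl
  intro y hy
  induction hy with
  | single h =>
    rintro e rfl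
    cases h with
    | implicit s a y h => exact ⟨s, a, [], by rw [read_nil, h]⟩
  | tail _ h ih =>
    rintro e rfl
    cases h with
    | implicit s a y h => exact ⟨s, a, [], by rw [read_nil, h]⟩
    | explicit e' b y h =>
      obtain ⟨t, a, u, hu⟩ := ih e' rfl
      refine ⟨t, a, u ++ [b], ?_⟩
      rw [read_append, hu]
      simp [readBits, h]

theorem WellFormed.wellFounded_reaches [Finite SI] [Finite SE] (hA : A.WellFormed) :
    WellFounded fun y x => A.Reaches x y := by
  have : IsTrans (SI ⊕ SE) fun y x => A.Reaches x y := ⟨fun _ _ _ h h' => h'.trans h⟩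
  have : Std.Irrefl fun y x : SI ⊕ SE => A.Reaches x y := ⟨hA.acyclic⟩
  exact Finite.wellFounded_of_trans_of_irrefl _

theorem WellFormed.exists_readBits_eq_inl [Finite SI] [Finite SE] (hA : A.WellFormed)
    (x : SI ⊕ SE) (w : ℕ → Bool) :
    ∃ k s, A.readBits x (List.ofFn fun j : Fin k => w j) = some (Sum.inl s) := by
  induction x using hA.wellFounded_reaches.induction generalizing w with
  | _ x ih =>
    cases x with
    | inl s => exact ⟨0, s, by simp [readBits]⟩
    | inr e =>
      obtain ⟨y, hy⟩ := Option.isSome_iff_exists.1 (hA.completeE e (w 0))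
      obtain ⟨k, s, hk⟩ := ih y (.single (.explicit e _ y hy)) fun m => w (m + 1)
      refine ⟨k + 1, s, ?_⟩
      rw [List.ofFn_succ]
      simpa [readBits, hy] using hk

theorem WellFormed.exists_read_eq_inl [Finite SI] [Finite SE] (hA : A.WellFormed)
    {s : SI} {v : Fin n → ℝ} {a : FaceSymbol} {w : ℕ → Bool} (h : IsEncoding (A.VS s) v a w) :
    ∃ k s', A.read s a (List.ofFn fun j : Fin k => w j) = some (Sum.inl s') := by
  obtain ⟨y, hy⟩ := Option.isSome_iff_exists.1 ((hA.completeI s a).2 h.le_codim)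
  obtain ⟨k, s', hk⟩ := hA.exists_readBits_eq_inl y w
  exact ⟨k, s', by rw [read, hy]; exact hk⟩

/-- Every vector of a region leads, by reading one of its encodings further, to an implicit
state. -/
theorem WellFormed.exists_read_append_eq_inl [Finite SI] [Finite SE] (hA : A.WellFormed)
    {s : SI} {v : Fin n → ℝ} {a : FaceSymbol} {u : List Bool} {y : SI ⊕ SE}
    (hv : v ∈ prefixRegion (A.VS s) a u) (hy : A.read s a u = some y) :
    ∃ u' s', A.readBits y u' = some (Sum.inl s') ∧ A.read s a (u ++ u') = some (Sum.inl s') ∧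
      v ∈ prefixRegion (A.VS s) a (u ++ u') := by
  obtain ⟨w, hw, hu⟩ := hv
  obtain ⟨k, s', hk⟩ := hA.exists_readBits_eq_inl y fun m => w (u.length + m)
  refine ⟨_, s', hk, by rw [read_append, hy]; exact hk, ?_⟩
  have : u ++ (List.ofFn fun j : Fin k => w (u.length + j)) =
      List.ofFn fun j : Fin (u.length + k) => w j := by
    conv_lhs => rw [← hu]
    rw [List.ofFn_add]
    simp
  rw [this]
  exact hw.mem_prefixRegion _

/-- Following the transitions, the labels increase for the incidence relation. -/
theorem IsLabelling.exists_incidentOrEq {P : Set (Fin n → ℝ)} {c : SI → Set (Fin n → ℝ)}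
    (hc : A.IsLabelling P c) (hP : LocallyConical P) {x : SI ⊕ SE} {t : SI}
    (h : Relation.ReflTransGen A.Trans x (Sum.inl t)) :
    ∃ u s, A.readBits x u = some (Sum.inl s) ∧ IncidentOrEq P (c s) (c t) := by
  induction h using Relation.ReflTransGen.head_induction_on with
  | refl => exact ⟨[], t, rfl, Or.inl rfl⟩
  | head h _ ih =>
    obtain ⟨u, s', hu, hs'⟩ := ih
    cases h with
    | implicit s a y h =>
      refine ⟨[], s, rfl, IncidentOrEq.trans hP ?_ hs'⟩
      exact incidentOrEq_of_mem_coveredComponents (hc.isComponent s)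
        (hc.sound s a u s' (by rw [read, h]; exact hu)).mem
    | explicit e b y h => exact ⟨b :: u, s', by simpa [readBits, h] using hu, hs'⟩

theorem IsLabelling.incidentOrEq_of_reaches {P : Set (Fin n → ℝ)} {c : SI → Set (Fin n → ℝ)}
    (hc : A.IsLabelling P c) (hP : LocallyConical P) {s t : SI}
    (h : A.Reaches (Sum.inl s) (Sum.inl t)) : IncidentOrEq P (c s) (c t) := by
  obtain ⟨u, s', hu, hs'⟩ := hc.exists_incidentOrEq hP h.to_reflTransGen
  obtain ⟨-, hs⟩ := readBits_inl hu
  rwa [Sum.inl_injective hs] at hs'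

end runs

/-! ### Soundness of the decision procedure -/

section decision

variable {n : ℕ} {SI SE : Type*} {A : IRVA n SI SE} {P : Set (Fin n → ℝ)}
  {c : SI → Set (Fin n → ℝ)}

/-- The properties of a labelling that make the decision procedure correct. Unlike `IsLabelling`
and `WellFormed`, they are preserved by absorptions. -/
structure IsSoundLabelling (A : IRVA n SI SE) (P : Set (Fin n → ℝ))
    (c : SI → Set (Fin n → ℝ)) : Prop where
  isComponent : ∀ s, IsComponent P (c s)
  space_le : ∀ s, A.VS s ≤ componentSpace (c s)
  polarity : ∀ s v, component P v = c s → (A.pol s = true ↔ v ∈ P)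
  initial : c A.init = component P 0
  sound : ∀ s a u s', A.read s a u = some (Sum.inl s') →
    IsUniqueMinimal P (coveredComponents P (c s) (prefixRegion (A.VS s) a u)) (c s')
  increasing : ∀ s a u s', A.read s a u = some (Sum.inl s') → A.VS s < A.VS s'
  total : ∀ s v a w, IsEncoding (A.VS s) v a w →
    ∃ k s', A.read s a (List.ofFn fun j : Fin k => w j) = some (Sum.inl s')

/-- The invariant of the decision procedure: in an implicit state, the answer is membership in the
cone of the component with which the state is labelled. -/
theorem IsSoundLabelling.answer_iff (hc : A.IsSoundLabelling P c) (hP : LocallyConical P)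
    {v : Fin n → ℝ} {s : SI} {b : Bool} (h : A.Answers v s b) {q : Fin n → ℝ}
    (hq : component P q = c s) : b = true ↔ v ∈ localCone P q := by
  induction h generalizing q with
  | halt s hv =>
    have hmem := hc.space_le s hv
    rw [← hq, componentSpace_component] at hmem
    have := hmem 1 0
    rw [zero_add, one_smul, zero_mem_localCone] at this
    rw [hc.polarity s q hq, this]
  | move s s' b hv hmove _ ih =>
    obtain ⟨a, w, k, henc, hread⟩ := hmove
    obtain ⟨q', hq'⟩ := hc.isComponent s'
    have hs := hc.sound s a _ s' hread
    rw [← hq, ← hq'] at hs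
    rw [ih hq', hs.mem_localCone_iff hP smul_mem_prefixRegion segment_subset_prefixRegion
      (henc.mem_prefixRegion k)]

theorem IsSoundLabelling.exists_answer (hc : A.IsSoundLabelling P c) (v : Fin n → ℝ) (s : SI) :
    ∃ b, A.Answers v s b := by
  induction hd : n - Module.finrank ℝ (A.VS s) using Nat.strong_induction_on generalizing s with
  | _ d ih =>
    by_cases hv : v ∈ A.VS s
    · exact ⟨_, .halt s hv⟩
    obtain ⟨a, w, henc⟩ := exists_isEncoding hv
    obtain ⟨k, s', hk⟩ := hc.total s v a w henc
    have h1 := Submodule.finrank_lt_finrank_of_lt (hc.increasing s a _ s' hk)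
    have h2 := Submodule.finrank_le (A.VS s')
    rw [Module.finrank_fin_fun] at h2
    obtain ⟨b, hb⟩ := ih _ (by omega) s' rfl
    exact ⟨b, .move s s' b hv ⟨a, w, k, henc, hk⟩ hb⟩

theorem localCone_zero_of_conicalIn (hcone : ConicalIn P Set.univ 0) : localCone P 0 = P := by
  ext x
  have : ∀ᶠ ε in 𝓝[>] (0 : ℝ), ((0 : Fin n → ℝ) + ε • x ∈ P ↔ x ∈ P) := by
    filter_upwards [Ioo_mem_nhdsGT (zero_lt_one' ℝ)] with ε hε
    have := hcone.2 x trivial ε hε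
    rw [sub_zero, add_zero] at this
    rw [zero_add, this]
  exact (eventually_congr this).trans eventually_const

theorem IsSoundLabelling.decides (hc : A.IsSoundLabelling P c) (hP : LocallyConical P)
    (hcone : ConicalIn P Set.univ 0) : A.Decides P := by
  have key : ∀ v b, A.Answers v A.init b → (b = true ↔ v ∈ P) := fun v b h => by
    rw [hc.answer_iff hP h hc.initial.symm, localCone_zero_of_conicalIn hcone]
  refine fun v b => ⟨key v b, fun h => ?_⟩
  obtain ⟨b', hb'⟩ := hc.exists_answer v A.init
  obtain rfl : b = b' := by rw [Bool.eq_iff_iff, h, key v b' hb']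
  exact hb'

/-- The redirection to `s₁` of what leads to `s`. -/
noncomputable def redirect (s s₁ : SI) (y : SI ⊕ SE) : SI ⊕ SE :=
  open scoped Classical in if y = Sum.inl s then Sum.inl s₁ else y

theorem redirect_inr (s s₁ : SI) (e : SE) :
    redirect s s₁ (Sum.inr e : SI ⊕ SE) = Sum.inr e := if_neg (by simp)

theorem readBits_absorb (s s₁ : SI) (x : SI ⊕ SE) (u : List Bool) :
    (A.absorb s s₁).readBits (redirect s s₁ x) u = (A.readBits x u).map (redirect s s₁) := by
  induction u generalizing x with
  | nil => rfl
  | cons b u ih =>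
    cases x with
    | inl t =>
      rw [redirect]
      split_ifs <;> rfl
    | inr e =>
      rw [redirect_inr]
      have h : (A.absorb s s₁).stepE e b = (A.stepE e b).map (redirect s s₁) := rfl
      simp only [readBits, h]
      cases A.stepE e b with
      | none => rfl
      | some y => exact ih y

theorem read_absorb (s s₁ t : SI) (a : FaceSymbol) (u : List Bool) :
    (A.absorb s s₁).read t a u = (A.read t a u).map (redirect s s₁) := by
  have h : (A.absorb s s₁).stepI t a = (A.stepI t a).map (redirect s s₁) := rfl
  simp only [read, h]
  cases A.stepI t a with
  | none => rfl
  | some y => exact readBits_absorb s s₁ y u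

/-- After the absorption of a state by a state with the same label, the labelling is still
sound. -/
theorem IsLabelling.isSoundLabelling_absorb [Finite SI] [Finite SE] (hc : A.IsLabelling P c)
    (hA : A.WellFormed) {s s₁ : SI} (hcs : c s = c s₁)
    (hlt : A.VS s < A.VS s₁) : (A.absorb s s₁).IsSoundLabelling P c := by
  have hread : ∀ t a u t', (A.absorb s s₁).read t a u = some (Sum.inl t') →
      ∃ t'', A.read t a u = some (Sum.inl t'') ∧ c t'' = c t' ∧ A.VS t'' ≤ A.VS t' := by
    intro t a u t' h
    rw [read_absorb, Option.map_eq_some_iff] at h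
    obtain ⟨y, hy, hy'⟩ := h
    rw [redirect] at hy'
    split_ifs at hy' with heq
    · obtain rfl := Sum.inl_injective hy'
      exact ⟨s, heq ▸ hy, hcs, hlt.le⟩
    · exact ⟨t', hy' ▸ hy, rfl, le_rfl⟩
  refine ⟨hc.isComponent, hc.space_le, hc.polarity, ?_, ?_, ?_, ?_⟩
  · rw [← hc.initial]
    simp only [absorb]
    split_ifs with h
    · rw [h, hcs]
    · rfl
  · intro t a u t' h
    obtain ⟨t'', h1, h2, -⟩ := hread t a u t' h
    rw [← h2]
    exact hc.sound t a u t'' h1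
  · intro t a u t' h
    obtain ⟨t'', h1, -, h3⟩ := hread t a u t' h
    exact (hA.increasing t t'' (reaches_of_read h1)).trans_le h3
  · intro t v a w h
    obtain ⟨k, t', ht'⟩ := hA.exists_read_eq_inl (s := t) h
    classical
    refine ⟨k, if t' = s then s₁ else t', ?_⟩
    rw [read_absorb, ht', Option.map_some, redirect]
    simp only [Sum.inl.injEq]
    split_ifs <;> rfl

end decision

end IRVA

namespace IRVA

/-! ### Behaviours -/

section behaviour

variable {n : ℕ} {SI SE SI' SE' : Type*} {A : IRVA n SI SE} {A' : IRVA n SI' SE'}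
  {P : Set (Fin n → ℝ)} {c : SI → Set (Fin n → ℝ)} {c' : SI' → Set (Fin n → ℝ)}

/-- What is observed in a state: the label of an implicit state, and nothing in an explicit one. -/
def observe (c : SI → Set (Fin n → ℝ)) : SI ⊕ SE → Option (Set (Fin n → ℝ)) :=
  Sum.elim (fun s => some (c s)) fun _ => none

/-- The behaviour of a state: what is observed after having read a word of bits, if this word can be
read. -/
def behaviour (A : IRVA n SI SE) (c : SI → Set (Fin n → ℝ)) (x : SI ⊕ SE) (u : List Bool) :
    Option (Option (Set (Fin n → ℝ))) :=
  (A.readBits x u).map (observe c)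

/-- In a well-formed automaton whose mergeable explicit states are merged, states are determined by
their behaviour as soon as the implicit states that they reach are determined by their labels. -/
theorem eq_of_behaviour_eq [Finite SI] [Finite SE] (hA : A.WellFormed)
    (hmerge : ∀ e e' : SE, (∀ b, A.stepE e b = A.stepE e' b) → e = e') {x x' : SI ⊕ SE}
    (hinj : ∀ s t, Relation.ReflTransGen A.Trans x (Sum.inl s) →
      Relation.ReflTransGen A.Trans x' (Sum.inl t) → c s = c t → s = t)
    (h : A.behaviour c x = A.behaviour c x') : x = x' := by
  induction x using hA.wellFounded_reaches.induction generalizing x' with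
  | _ x ih =>
    have h0 := congrFun h []
    simp only [behaviour, readBits, Option.map_some, Option.some.injEq] at h0
    match x, x' with
    | Sum.inl s, Sum.inl t => rw [hinj s t .refl .refl (Option.some.inj h0)]
    | Sum.inl s, Sum.inr e => simp [observe] at h0
    | Sum.inr e, Sum.inl s => simp [observe] at h0
    | Sum.inr e, Sum.inr e' =>
      rw [hmerge e e' fun b => ?_]
      obtain ⟨y, hy⟩ := Option.isSome_iff_exists.1 (hA.completeE e b)
      obtain ⟨y', hy'⟩ := Option.isSome_iff_exists.1 (hA.completeE e' b)
      have hxy := Trans.explicit e b y hy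
      have hxy' := Trans.explicit e' b y' hy'
      rw [hy, hy', ih y (.single hxy) (fun s t hs ht => hinj s t (.head hxy hs) (.head hxy' ht))]
      funext u
      have := congrFun h (b :: u)
      simpa [behaviour, readBits, hy, hy'] using this

/-- The automaton leaves `s` for an implicit state as soon as the prefix that is read determines a
unique minimal component. -/
def IsEager (A : IRVA n SI SE) (P : Set (Fin n → ℝ)) (c : SI → Set (Fin n → ℝ)) (s : SI) : Prop :=
  ∀ a u e, A.read s a u = some (Sum.inr e) →
    ∀ Q, ¬ IsUniqueMinimal P (coveredComponents P (c s) (prefixRegion (A.VS s) a u)) Q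

theorem IsEager.observe_eq_some_iff (hc : A.IsLabelling P c) {s : SI} (hs : A.IsEager P c s)
    {a : FaceSymbol} {u : List Bool} {y : SI ⊕ SE} (hy : A.read s a u = some y)
    (Q : Set (Fin n → ℝ)) : observe c y = some Q ↔
      IsUniqueMinimal P (coveredComponents P (c s) (prefixRegion (A.VS s) a u)) Q := by
  cases y with
  | inl t =>
    have := hc.sound s a u t hy
    refine Option.some_inj.trans ⟨fun h => h ▸ this, fun h => this.eq h⟩
  | inr e => exact iff_of_false (by simp [observe]) (hs a u e hy Q)

/-- What is observed from an eager state depends only on its label and vector space: an eager state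
has no choice left. -/
theorem IsEager.map_observe_read_eq (hA : A.WellFormed) (hA' : A'.WellFormed)
    (hc : A.IsLabelling P c) (hc' : A'.IsLabelling P c') {s : SI} {s' : SI'}
    (hs : A.IsEager P c s) (hs' : A'.IsEager P c' s') (hcs : c s = c' s')
    (hVS : A.VS s = A'.VS s') (a : FaceSymbol) (u : List Bool) :
    (A.read s a u).map (observe c) = (A'.read s' a u).map (observe c') := by
  suffices hsome : (A.read s a u).isSome = (A'.read s' a u).isSome by
    cases h : A.read s a u with
    | none =>
      rw [h] at hsome
      rw [Option.isSome_eq_false_iff.1 hsome.symm |> Option.isNone_iff_eq_none.1]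
      rfl
    | some y =>
      rw [h] at hsome
      obtain ⟨y', h'⟩ := Option.isSome_iff_exists.1 hsome.symm
      rw [h', Option.map_some, Option.map_some]
      congr 1
      refine Option.ext fun Q => ?_
      rw [hs.observe_eq_some_iff hc h, hs'.observe_eq_some_iff hc' h', hcs, hVS]
  induction u using List.reverseRecOn with
  | nil => rw [read_nil, read_nil, Bool.eq_iff_iff, hA.completeI, hA'.completeI, hVS]
  | append_singleton u b ih =>
    rw [read_append, read_append]
    cases h : A.read s a u with
    | none =>
      rw [h] at ih
      rw [Option.isSome_eq_false_iff.1 ih.symm |> Option.isNone_iff_eq_none.1]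
      rfl
    | some y =>
      rw [h] at ih
      obtain ⟨y', h'⟩ := Option.isSome_iff_exists.1 ih.symm
      rw [h', Option.bind_some, Option.bind_some]
      have hobs : observe c y = observe c' y' := by
        refine Option.ext fun Q => ?_
        rw [hs.observe_eq_some_iff hc h, hs'.observe_eq_some_iff hc' h', hcs, hVS]
      match y, y' with
      | Sum.inl t, Sum.inl t' => rfl
      | Sum.inl t, Sum.inr e => simp [observe] at hobs
      | Sum.inr e, Sum.inl t => simp [observe] at hobs
      | Sum.inr e, Sum.inr e' =>
        obtain ⟨z, hz⟩ := Option.isSome_iff_exists.1 (hA.completeE e b)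
        obtain ⟨z', hz'⟩ := Option.isSome_iff_exists.1 (hA'.completeE e' b)
        simp [readBits, hz, hz']

/-- Two eager states with the same label and the same vector space lead, by the same word, to states
with the same behaviour. -/
theorem IsEager.behaviour_eq (hA : A.WellFormed) (hA' : A'.WellFormed)
    (hc : A.IsLabelling P c) (hc' : A'.IsLabelling P c') {s : SI} {s' : SI'}
    (hs : A.IsEager P c s) (hs' : A'.IsEager P c' s') (hcs : c s = c' s')
    (hVS : A.VS s = A'.VS s') {a : FaceSymbol} {u : List Bool} {y : SI ⊕ SE} {y' : SI' ⊕ SE'}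
    (hy : A.read s a u = some y) (hy' : A'.read s' a u = some y') :
    A.behaviour c y = A'.behaviour c' y' := by
  funext u'
  have := hs.map_observe_read_eq hA hA' hc hc' hs' hcs hVS a (u ++ u')
  rwa [read_append, read_append, hy, hy'] at this

end behaviour

/-! ### States of a minimized automaton -/

section minimized

variable {n : ℕ} {SI SE : Type*} {A : IRVA n SI SE} {P : Set (Fin n → ℝ)}
  {c : SI → Set (Fin n → ℝ)}

/-- A component has at most one implicit state labelled with it. -/
def HasUniqueState (c : SI → Set (Fin n → ℝ)) (Q : Set (Fin n → ℝ)) : Prop :=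
  ∀ s t, c s = Q → c t = Q → s = t

/-- The implicit states that are reachable from a state describing its component are labelled with
other components, since their vector space is larger. -/
theorem IsLabelling.incident_of_reaches (hc : A.IsLabelling P c) (hA : A.WellFormed)
    (hP : LocallyConical P) {s t : SI} (hs : A.VS s = componentSpace (c s))
    (h : A.Reaches (Sum.inl s) (Sum.inl t)) : Incident P (c s) (c t) := by
  refine (hc.incidentOrEq_of_reaches hP h).resolve_left fun heq => ?_
  have h1 := hA.increasing s t h
  rw [hs, heq] at h1
  exact h1.not_ge (hc.space_le t)

/-- A state with a transition to `s₁`, where `s₁` is the only state describing a component `Q`, is a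
candidate for absorption when the other implicit states that it reaches are labelled with
components incident to `Q`, each of which labels only one state. -/
theorem IsLabelling.absorptionCandidate (hc : A.IsLabelling P c) {x : SI ⊕ SE} {s₁ : SI}
    (hx : A.Trans x (Sum.inl s₁)) (hs₁ : A.VS s₁ = componentSpace (c s₁))
    (huniq : ∀ t, c t = c s₁ → A.VS t = componentSpace (c t) → t = s₁)
    (habove : ∀ Q, Incident P (c s₁) Q → HasUniqueState c Q)
    (hreach : ∀ t, A.Reaches x (Sum.inl t) → t = s₁ ∨ Incident P (c s₁) (c t)) :
    A.AbsorptionCandidate P x s₁ := by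
  refine ⟨hx, ⟨c, hc, hs₁⟩, fun t ht => (hreach t ht).imp_right fun hinc => ?_⟩
  obtain ⟨r₁, r₂, ⟨h1, h1'⟩, ⟨h2, -⟩, hr⟩ := hc.incidence _ _ hinc
  rwa [huniq r₁ h1 (h1 ▸ h1'), habove _ hinc r₂ t h2 rfl] at hr

/-- In a minimized automaton, no explicit state leads to `s₁` under the conditions of
`IsLabelling.absorptionCandidate`: the last explicit state before `s₁` could be absorbed. -/
theorem IsLabelling.readBits_ne_of_isMinimized (hc : A.IsLabelling P c) (hmin : A.IsMinimized P)
    {e : SE} {u : List Bool} {s₁ : SI} (hs₁ : A.VS s₁ = componentSpace (c s₁))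
    (huniq : ∀ t, c t = c s₁ → A.VS t = componentSpace (c t) → t = s₁)
    (habove : ∀ Q, Incident P (c s₁) Q → HasUniqueState c Q)
    (hreach : ∀ t, A.Reaches (Sum.inr e) (Sum.inl t) → t = s₁ ∨ Incident P (c s₁) (c t)) :
    A.readBits (Sum.inr e) u ≠ some (Sum.inl s₁) := by
  intro h
  obtain ⟨e', h1, h2⟩ := exists_explicit_trans h
  exact hmin.absorb_explicit e' s₁ (hc.absorptionCandidate h2 hs₁ huniq habove
    fun t ht => hreach t (ht.trans_right h1))

theorem HasUniqueState.describes (hc : A.IsLabelling P c) {s : SI}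
    (h : HasUniqueState c (c s)) : A.VS s = componentSpace (c s) := by
  obtain ⟨t, ht, ht'⟩ := hc.described (c s) (hc.isComponent s)
  rwa [h t s ht rfl] at ht'

/-- By the absorption rule, explicit states do not delay the choice of a unique minimal component
`Q`: the state labelled with `Q` would still be reached, and what is reached besides is reached
from it. -/
theorem IsLabelling.isEager [Finite SI] [Finite SE] (hc : A.IsLabelling P c) (hA : A.WellFormed)
    (hP : LocallyConical P) (hmin : A.IsMinimized P) {s : SI}
    (hs : A.VS s = componentSpace (c s))
    (habove : ∀ Q, Incident P (c s) Q → HasUniqueState c Q) : A.IsEager P c s := by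
  intro a u e he Q hQ
  obtain ⟨q, hq⟩ := hc.isComponent s
  have hmem := hQ.mem
  rw [← hq] at hmem
  obtain ⟨x, hx, hxQ⟩ := (mem_coveredComponents_iff hP smul_mem_prefixRegion q).1 hmem
  obtain ⟨u', s', h1, h2, hx'⟩ := hA.exists_read_append_eq_inl hx he
  have hs' := hc.sound s a _ s' h2
  have below : ∀ t u'', A.read s a (u ++ u'') = some (Sum.inl t) → IncidentOrEq P Q (c t) :=
    fun t u'' h => hQ.incidentOrEq hP
      (coveredComponents_mono (prefixRegion_append_subset _ _ _ _) (hc.sound s a _ t h).mem)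
  obtain rfl : c s' = Q := by
    refine IncidentOrEq.antisymm hP (hs'.incidentOrEq hP ?_) (below s' u' h2)
    rw [← hq]
    exact (mem_coveredComponents_iff hP smul_mem_prefixRegion q).2 ⟨x, hx', hxQ⟩
  have hinc := hc.incident_of_reaches hA hP hs (reaches_of_read h2)
  have huniq := habove _ hinc
  refine hc.readBits_ne_of_isMinimized hmin (huniq.describes hc)
    (fun t ht _ => huniq t s' ht rfl) (fun Q' hQ' => habove Q' (hinc.trans hP hQ'))
    (fun t ht => ?_) h1
  obtain ⟨u'', t', h3, h4⟩ := hc.exists_incidentOrEq hP ht.to_reflTransGen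
  have h5 := below t' u'' (by rw [read_append, he]; exact h3)
  exact (h5.trans hP h4).imp_left fun heq => huniq t s' heq.symm rfl

/-- By the merging rules, a component is described by only one state. -/
theorem IsLabelling.eq_of_describes [Finite SI] [Finite SE] (hc : A.IsLabelling P c)
    (hA : A.WellFormed) (hP : LocallyConical P) (hmin : A.IsMinimized P) {s t : SI}
    (hs : A.VS s = componentSpace (c s)) (ht : A.VS t = componentSpace (c t)) (hst : c s = c t)
    (habove : ∀ Q, Incident P (c s) Q → HasUniqueState c Q) : s = t := by
  have hVS : A.VS s = A.VS t := by rw [hs, ht, hst]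
  have es := hc.isEager hA hP hmin hs habove
  have et := hc.isEager hA hP hmin ht (hst ▸ habove)
  refine hmin.merge_implicit s t hVS ?_ fun a => ?_
  · obtain ⟨q, hq⟩ := hc.isComponent s
    rw [Bool.eq_iff_iff, hc.polarity s q hq, hc.polarity t q (hq.trans hst)]
  · have hobs := es.map_observe_read_eq hA hA hc hc et hst hVS a []
    rw [read_nil, read_nil] at hobs
    cases h : A.stepI s a with
    | none =>
      rw [h, Option.map_none, eq_comm, Option.map_eq_none_iff] at hobs
      exact hobs.symm
    | some y =>
      rw [h, Option.map_some, eq_comm, Option.map_eq_some_iff] at hobs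
      obtain ⟨y', h', -⟩ := hobs
      have hbeh := es.behaviour_eq hA hA hc hc et hst hVS (by rw [read_nil, h])
        (by rw [read_nil, h'])
      rw [h', eq_of_behaviour_eq hA hmin.merge_explicit (fun r r' hr _ heq => ?_) hbeh]
      have := hc.incident_of_reaches hA hP hs (.head' (.implicit s a y h) hr)
      exact habove _ this r r' rfl heq.symm

/-- By the absorption rule, a state with a smaller vector space than its component is redundant. -/
theorem IsLabelling.describes_of_isMinimized [Finite SI] [Finite SE] (hc : A.IsLabelling P c)
    (hA : A.WellFormed) (hP : LocallyConical P) (hcone : ConicalIn P Set.univ 0)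
    (hmin : A.IsMinimized P) {s : SI} (habove : ∀ Q, Incident P (c s) Q → HasUniqueState c Q) :
    A.VS s = componentSpace (c s) := by
  -- A state labelled with the same component whose vector space is maximal among those that do
  -- not describe it can only reach the state that does.
  induction hd : n - Module.finrank ℝ (A.VS s) using Nat.strong_induction_on generalizing s with
  | _ d ih =>
    have ih' : ∀ t, A.Reaches (Sum.inl s) (Sum.inl t) → c s = c t →
        A.VS t = componentSpace (c t) := by
      intro t ht heq
      have h1 := Submodule.finrank_lt_finrank_of_lt (hA.increasing s t ht)
      have h2 := Submodule.finrank_le (A.VS t)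
      rw [Module.finrank_fin_fun] at h2
      exact ih _ (by omega) (heq ▸ habove) rfl
    by_contra hne
    obtain ⟨v, hv, hv'⟩ := SetLike.exists_of_lt (lt_of_le_of_ne (hc.space_le s) hne)
    obtain ⟨a, w, henc⟩ := exists_isEncoding hv'
    obtain ⟨k, s₁, hk⟩ := hA.exists_read_eq_inl henc
    have hr := reaches_of_read hk
    obtain ⟨q, hq⟩ := hc.isComponent s
    have hs₁ : c s = c s₁ := by
      refine IncidentOrEq.antisymm hP (hc.incidentOrEq_of_reaches hP hr)
        ((hc.sound s a _ s₁ hk).incidentOrEq hP ?_)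
      rw [← hq, componentSpace_component] at hv
      rw [← hq]
      refine (mem_coveredComponents_iff hP smul_mem_prefixRegion q).2
        ⟨v, henc.mem_prefixRegion k, ?_⟩
      rw [component_eq_component_iff,
        (isScalingInvariant_localCone P q).localCone_of_mem_lineality hv]
    have hd₁ := ih' s₁ hr hs₁
    have habove₁ : ∀ Q, Incident P (c s₁) Q → HasUniqueState c Q := hs₁ ▸ habove
    have huniq : ∀ t, c t = c s₁ → A.VS t = componentSpace (c t) → t = s₁ :=
      fun t ht ht' => hc.eq_of_describes hA hP hmin ht' hd₁ ht (ht ▸ habove₁)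
    have hreach : ∀ t, A.Reaches (Sum.inl s) (Sum.inl t) → t = s₁ ∨ Incident P (c s₁) (c t) := by
      intro t ht
      rw [← hs₁]
      exact (hc.incidentOrEq_of_reaches hP ht).imp_left
        fun heq => huniq t (heq.symm.trans hs₁) (ih' t ht heq)
    obtain ⟨y, hy, hy'⟩ := Option.bind_eq_some_iff.1 hk
    have htrans := Trans.implicit s a y hy
    cases y with
    | inl t =>
      rw [← (readBits_inl hy').2] at htrans
      refine hmin.absorb_implicit s s₁ (hc.absorptionCandidate htrans hd₁ huniq habove₁ hreach) ?_
        ((hc.isSoundLabelling_absorb hA hs₁ (hA.increasing s s₁ hr)).decides hP hcone)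
      rw [Bool.eq_iff_iff, hc.polarity s q hq, hc.polarity s₁ q (hq.trans hs₁)]
    | inr e =>
      exact hc.readBits_ne_of_isMinimized hmin hd₁ huniq habove₁
        (fun t ht => hreach t (.head htrans ht)) hy'

/-- In a minimized automaton, each component labels only one implicit state. -/
theorem IsLabelling.hasUniqueState [Finite SI] [Finite SE] (hc : A.IsLabelling P c)
    (hA : A.WellFormed) (hP : LocallyConical P) (hcone : ConicalIn P Set.univ 0)
    (hmin : A.IsMinimized P) (Q : Set (Fin n → ℝ)) : HasUniqueState c Q := by
  induction hd : n - Module.finrank ℝ (componentSpace Q) using Nat.strong_induction_on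
    generalizing Q with
  | _ d ih =>
    have habove : ∀ Q', Incident P Q Q' → HasUniqueState c Q' := by
      intro Q' hQ'
      have h1 := Submodule.finrank_lt_finrank_of_lt (hQ'.componentSpace_lt hP)
      have h2 := Submodule.finrank_le (componentSpace Q')
      rw [Module.finrank_fin_fun] at h2
      exact ih _ (by omega) Q' rfl
    rintro s t rfl ht
    exact hc.eq_of_describes hA hP hmin
      (hc.describes_of_isMinimized hA hP hcone hmin habove)
      (hc.describes_of_isMinimized hA hP hcone hmin (ht ▸ habove)) ht.symm habove

end minimized

/-! ### Comparison of two minimized automata -/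

section comparison

variable {n : ℕ} {SI₁ SE₁ SI₂ SE₂ : Type*}
  {A₁ : IRVA n SI₁ SE₁} {A₂ : IRVA n SI₂ SE₂} {P : Set (Fin n → ℝ)}
  {c₁ : SI₁ → Set (Fin n → ℝ)} {c₂ : SI₂ → Set (Fin n → ℝ)}

theorem exists_implicit_label_eq (hc₁ : A₁.IsLabelling P c₁) (hc₂ : A₂.IsLabelling P c₂)
    (s : SI₁) : ∃ t, c₂ t = c₁ s := by
  obtain ⟨t, ht, -⟩ := hc₂.described _ (hc₁.isComponent s)
  exact ⟨t, ht⟩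

variable [Finite SI₁] [Finite SE₁] [Finite SI₂] [Finite SE₂]

theorem IsLabelling.describes (hc₁ : A₁.IsLabelling P c₁) (hA₁ : A₁.WellFormed)
    (hP : LocallyConical P) (hcone : ConicalIn P Set.univ 0) (hmin₁ : A₁.IsMinimized P) (s : SI₁) :
    A₁.VS s = componentSpace (c₁ s) :=
  hc₁.describes_of_isMinimized hA₁ hP hcone hmin₁
    fun Q _ => hc₁.hasUniqueState hA₁ hP hcone hmin₁ Q

theorem IsLabelling.isEager_of_isMinimized (hc₁ : A₁.IsLabelling P c₁) (hA₁ : A₁.WellFormed)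
    (hP : LocallyConical P) (hcone : ConicalIn P Set.univ 0) (hmin₁ : A₁.IsMinimized P) (s : SI₁) :
    A₁.IsEager P c₁ s :=
  hc₁.isEager hA₁ hP hmin₁ (hc₁.describes hA₁ hP hcone hmin₁ s)
    fun Q _ => hc₁.hasUniqueState hA₁ hP hcone hmin₁ Q

/-- If `s` and `t` have the same label, a word that leads from `s` to `y` leads from `t` to a state
with the behaviour of `y`. -/
theorem exists_read_behaviour_eq (hA₁ : A₁.WellFormed) (hA₂ : A₂.WellFormed)
    (hc₁ : A₁.IsLabelling P c₁) (hc₂ : A₂.IsLabelling P c₂) (hP : LocallyConical P)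
    (hcone : ConicalIn P Set.univ 0) (hmin₁ : A₁.IsMinimized P) (hmin₂ : A₂.IsMinimized P)
    {s : SI₁} {t : SI₂} (hst : c₂ t = c₁ s) {a : FaceSymbol} {u : List Bool} {y : SI₁ ⊕ SE₁}
    (hy : A₁.read s a u = some y) :
    ∃ y', A₂.read t a u = some y' ∧ A₂.behaviour c₂ y' = A₁.behaviour c₁ y := by
  have hVS : A₁.VS s = A₂.VS t := by
    rw [hc₁.describes hA₁ hP hcone hmin₁, hc₂.describes hA₂ hP hcone hmin₂, hst]
  have es := hc₁.isEager_of_isMinimized hA₁ hP hcone hmin₁ s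
  have et := hc₂.isEager_of_isMinimized hA₂ hP hcone hmin₂ t
  have hobs := es.map_observe_read_eq hA₁ hA₂ hc₁ hc₂ et hst.symm hVS a u
  rw [hy, Option.map_some, eq_comm, Option.map_eq_some_iff] at hobs
  obtain ⟨y', hy', -⟩ := hobs
  exact ⟨y', hy', (es.behaviour_eq hA₁ hA₂ hc₁ hc₂ et hst.symm hVS hy hy').symm⟩

theorem exists_explicit_behaviour_eq (hA₁ : A₁.WellFormed) (hA₂ : A₂.WellFormed)
    (hc₁ : A₁.IsLabelling P c₁) (hc₂ : A₂.IsLabelling P c₂) (hP : LocallyConical P)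
    (hcone : ConicalIn P Set.univ 0) (hmin₁ : A₁.IsMinimized P) (hmin₂ : A₂.IsMinimized P)
    (e : SE₁) : ∃ e', A₂.behaviour c₂ (Sum.inr e') = A₁.behaviour c₁ (Sum.inr e) := by
  have hreach := (hmin₁.reachable (Sum.inr e)).resolve_left (by simp)
  obtain ⟨s, a, u, hu⟩ := exists_read_eq_explicit hreach
  obtain ⟨t, ht⟩ := exists_implicit_label_eq hc₁ hc₂ s
  obtain ⟨y, -, hbeh⟩ := exists_read_behaviour_eq hA₁ hA₂ hc₁ hc₂ hP hcone hmin₁ hmin₂ ht hu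
  cases y with
  | inl t' =>
    have := congrFun hbeh []
    simp [behaviour, readBits, observe] at this
  | inr e' => exact ⟨e', hbeh⟩

end comparison

end IRVA

theorem mainTheorem3 {n : ℕ} (hn : 0 < n) {SI₁ SE₁ SI₂ SE₂ : Type*}
    [Finite SI₁] [Finite SE₁] [Finite SI₂] [Finite SE₂]
    (P : Set (Fin n → ℝ)) (hP : IsPolyhedron P) (hcone : ConicalIn P Set.univ 0)
    (A₁ : IRVA n SI₁ SE₁) (A₂ : IRVA n SI₂ SE₂)
    (h₁ : A₁.Represents P) (h₂ : A₂.Represents P)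
    (hmin₁ : A₁.IsMinimized P) (hmin₂ : A₂.IsMinimized P) :
    ∃ (eI : SI₁ ≃ SI₂) (eE : SE₁ ≃ SE₂),
      eI A₁.init = A₂.init ∧
      (∀ s a, A₂.stepI (eI s) a = (A₁.stepI s a).map (Sum.map eI eE)) ∧
      (∀ e b, A₂.stepE (eE e) b = (A₁.stepE e b).map (Sum.map eI eE)) ∧
      (∀ s, A₂.VS (eI s) = A₁.VS s) ∧
      (∀ s, A₂.pol (eI s) = A₁.pol s) := by
  obtain ⟨hA₁, ⟨c₁, hc₁⟩, -⟩ := h₁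
  obtain ⟨hA₂, ⟨c₂, hc₂⟩, -⟩ := h₂
  have hL := hP.locallyConical
  have inj₁ : ∀ s t, c₁ s = c₁ t → s = t :=
    fun s t h => hc₁.hasUniqueState hA₁ hL hcone hmin₁ _ s t h rfl
  have inj₂ : ∀ s t, c₂ s = c₂ t → s = t :=
    fun s t h => hc₂.hasUniqueState hA₂ hL hcone hmin₂ _ s t h rfl
  have binj₁ : ∀ x y, A₁.behaviour c₁ x = A₁.behaviour c₁ y → x = y :=
    fun x y => IRVA.eq_of_behaviour_eq hA₁ hmin₁.merge_explicit fun s t _ _ => inj₁ s t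
  have binj₂ : ∀ x y, A₂.behaviour c₂ x = A₂.behaviour c₂ y → x = y :=
    fun x y => IRVA.eq_of_behaviour_eq hA₂ hmin₂.merge_explicit fun s t _ _ => inj₂ s t
  choose f hf using IRVA.exists_implicit_label_eq hc₁ hc₂
  choose g hg using IRVA.exists_explicit_behaviour_eq hA₁ hA₂ hc₁ hc₂ hL hcone hmin₁ hmin₂
  have hfbij : Function.Bijective f := by
    refine ⟨fun s t h => inj₁ s t (by rw [← hf, ← hf, h]), fun t => ?_⟩
    obtain ⟨s, hs⟩ := IRVA.exists_implicit_label_eq hc₂ hc₁ t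
    exact ⟨s, inj₂ _ _ (by rw [hf, hs])⟩
  have hgbij : Function.Bijective g := by
    refine ⟨fun e e' h => Sum.inr_injective (binj₁ _ _ (by rw [← hg, ← hg, h])), fun e' => ?_⟩
    obtain ⟨e, he⟩ :=
      IRVA.exists_explicit_behaviour_eq hA₂ hA₁ hc₂ hc₁ hL hcone hmin₂ hmin₁ e'
    exact ⟨e, Sum.inr_injective (binj₂ _ _ (by rw [hg, he]))⟩
  -- Both bijections preserve behaviours, which identify the targets of the transitions.
  have hmap : ∀ y, A₂.behaviour c₂ (Sum.map f g y) = A₁.behaviour c₁ y := by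
    rintro (s | e)
    · funext u
      cases u with
      | nil => simp [IRVA.behaviour, IRVA.readBits, IRVA.observe, hf]
      | cons b u => simp [IRVA.behaviour, IRVA.readBits]
    · exact hg e
  have hVS : ∀ s, A₂.VS (f s) = A₁.VS s := fun s => by
    rw [hc₁.describes hA₁ hL hcone hmin₁, hc₂.describes hA₂ hL hcone hmin₂, hf]
  refine ⟨Equiv.ofBijective f hfbij, Equiv.ofBijective g hgbij, ?_, fun s a => ?_, fun e b => ?_,
    hVS, fun s => ?_⟩
  · exact inj₂ _ _ (by rw [Equiv.ofBijective_apply, hf, hc₁.initial, hc₂.initial])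
  · change A₂.stepI (f s) a = (A₁.stepI s a).map (Sum.map f g)
    cases h : A₁.stepI s a with
    | none =>
      have := hA₂.completeI (f s) a
      rw [hVS, ← hA₁.completeI, h] at this
      simpa using this
    | some y =>
      obtain ⟨y', hy', hbeh⟩ := IRVA.exists_read_behaviour_eq hA₁ hA₂ hc₁ hc₂ hL hcone hmin₁ hmin₂
        (hf s) (u := []) (by rw [IRVA.read_nil, h])
      rw [IRVA.read_nil] at hy'
      rw [hy', Option.map_some, binj₂ _ _ (hbeh.trans (hmap y).symm)]
  · change A₂.stepE (g e) b = (A₁.stepE e b).map (Sum.map f g)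
    obtain ⟨y, hy⟩ := Option.isSome_iff_exists.1 (hA₁.completeE e b)
    obtain ⟨y', hy'⟩ := Option.isSome_iff_exists.1 (hA₂.completeE (g e) b)
    rw [hy, hy', Option.map_some, binj₂ y' (Sum.map f g y)]
    rw [hmap]
    funext u
    have := congrFun (hg e) (b :: u)
    simpa [IRVA.behaviour, IRVA.readBits, hy, hy'] using this
  · obtain ⟨q, hq⟩ := hc₁.isComponent s
    rw [Equiv.ofBijective_apply, Bool.eq_iff_iff, hc₁.polarity s q hq,
      hc₂.polarity (f s) q (hq.trans (hf s).symm)]
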